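/- For an oriented link diagram $D$ let $P_D(v,z)\in\mathbb{Z}[v^{\pm1},z^{\pm1}]$ be its Homflypt polynomial, i.e. the invariant of oriented links that equals $1$ on the trivial knot and satisfies the skein relation $P_{D_+}=vz\,P_{D_0}+v^2P_{D_-}$, and let $\nabla_D(z)=P_D(1,z)$ be its Conway polynomial. For an integer $p$ let $C_p(z)$ be the Conway polynomial of the closure of the two-strand braid $\sigma_1^p$. For a braid word $\beta$ let $w=w(\beta)$ be its writhe (exponent sum) and $\widehat\beta$ its standard closure; the generators $\sigma_i$ are positive crossings. Proposition. (1) Let $\beta$ be a braid word in $B_3$. There are unique polynomials $p_0,p_1,p_2\in\mathbb{Z}[z]$ with $$P_{\widehat\beta}(v,z)=\frac{v^{w}\left(p_0(z)+p_1(z)\,v^{2}+p_2(z)\,v^{4}\right)}{(vz)^{2}},$$ and they are given by $$p_0=C_{w+1}-\nabla_{\widehat\beta},\qquad p_1=z^2\,\nabla_{\widehat\beta}-p_0-p_2,\qquad p_2=C_{w-1}-\nabla_{\widehat\beta}.$$ (2) Hence the Homflypt polynomial of a closed 3-braid depends only on the writhe and the Conway polynomial: if $\beta,\gamma$ are braid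 words in $B_3$ with $w(\beta)=w(\gamma)$ and $\nabla_{\widehat\beta}=\nabla_{\widehat\gamma}$, then $P_{\widehat\beta}=P_{\widehat\gamma}$. -/

import Mathlib

set_option maxSynthPendingDepth 3

open scoped LaurentPolynomial Polynomial

noncomputable section

namespace Homflypt

/-! ### Oriented link diagrams

A diagram in general position with respect to the height function is read from the bottom to the
top as a sequence of layers; each layer holds one cup, one cap or one crossing, and otherwise
vertical strands. A horizontal section is recorded as the list of the orientations of its strands,
from left to right: `true` is upwards, `false` is downwards. -/

/-- The elementary pieces of a diagram.
* `cup o` : a local minimum, whose left end has the orientation `o`;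
* `cap` : a local maximum;
* `cross ε` : a crossing; for `ε = true` the strand that runs from the lower left to the upper right
  lies over the other one, for `ε = false` it lies under it. -/
inductive Piece : Type
  | cup (o : Bool) : Piece
  | cap : Piece
  | cross (ε : Bool) : Piece

/-- Number of end points at the bottom. -/
def Piece.inn : Piece → ℕ
  | .cup _ => 0
  | .cap => 2
  | .cross _ => 2

/-- Number of end points at the top. -/
def Piece.out : Piece → ℕ
  | .cup _ => 2
  | .cap => 0
  | .cross _ => 2

/-- `p.Joins x y`: the piece `p` can be oriented with bottom orientations `x` and top
orientations `y`. -/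
inductive Piece.Joins : Piece → List Bool → List Bool → Prop
  | cup (o : Bool) : Piece.Joins (.cup o) [] [o, !o]
  | cap (o : Bool) : Piece.Joins .cap [o, !o] []
  | cross (ε a b : Bool) : Piece.Joins (.cross ε) [a, b] [b, a]

/-- The layer `(i, p)` consists of the piece `p` with exactly `i` vertical strands to its left. -/
abbrev Layer : Type := ℕ × Piece

/-- `Step s (i, p) t`: the layer `(i, p)` leads from the section `s` to the section `t`. -/
inductive Step : List Bool → Layer → List Bool → Prop
  | mk (l r x y : List Bool) (p : Piece) (h : p.Joins x y) :
      Step (l ++ x ++ r) (l.length, p) (l ++ y ++ r)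

/-- `Runs s w t`: the layers in `w`, stacked from the bottom to the top, form an oriented tangle
diagram from the section `s` to the section `t`. -/
inductive Runs : List Bool → List Layer → List Bool → Prop
  | nil (s : List Bool) : Runs s [] s
  | cons {s t u : List Bool} {a : Layer} {w : List Layer} :
      Step s a t → Runs t w u → Runs s (a :: w) u

/-- (Non-empty) oriented link diagrams. -/
structure LinkDiagram : Type where
  word : List Layer
  runs : Runs [] word []
  nonempty : word ≠ []

/-- The local moves that generate isotopy of links: planar isotopy of diagrams
(`interchange`, `zigzag`, `zigzag'`, `slide_cap`, `slide_cup`) and the Reidemeister moves.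
The orientations of the strands are arbitrary, as far as they fit the pieces. -/
inductive Move : List Layer → List Layer → Prop
  /-- Two pieces that lie beside each other may exchange their heights. -/
  | interchange (i k : ℕ) (g h : Piece) :
      Move [(i, g), (i + g.out + k, h)] [(i + g.inn + k, h), (i, g)]
  /-- A minimum and a maximum of the same strand cancel. -/
  | zigzag (i : ℕ) (o : Bool) : Move [(i + 1, .cup o), (i, .cap)] []
  | zigzag' (i : ℕ) (o : Bool) : Move [(i, .cup o), (i + 1, .cap)] []
  /-- A strand that ends between the legs of a maximum (minimum) may cross either leg. -/
  | slide_cap (i : ℕ) (ε : Bool) :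
      Move [(i, .cross ε), (i + 1, .cap)] [(i + 1, .cross !ε), (i, .cap)]
  | slide_cup (i : ℕ) (o ε : Bool) :
      Move [(i + 1, .cup o), (i, .cross ε)] [(i, .cup o), (i + 1, .cross !ε)]
  /-- First Reidemeister move, at a minimum and at a maximum. -/
  | reidemeister₁_cup (i : ℕ) (o ε : Bool) :
      Move [(i, .cup o), (i, .cross ε)] [(i, .cup !o)]
  | reidemeister₁_cap (i : ℕ) (ε : Bool) :
      Move [(i, .cross ε), (i, .cap)] [(i, .cap)]
  /-- Second Reidemeister move. -/
  | reidemeister₂ (i : ℕ) (ε : Bool) : Move [(i, .cross ε), (i, .cross !ε)] []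
  /-- Third Reidemeister move. With the three strands numbered from left to right at the bottom, `a`,
  `b`, `c` say whether the first lies over the second, the first over the third and the second over
  the third; the condition excludes the cyclic cases. -/
  | reidemeister₃ (i : ℕ) (a b c : Bool) (h : a = c → b = a) :
      Move [(i, .cross a), (i + 1, .cross b), (i, .cross c)]
        [(i + 1, .cross c), (i, .cross b), (i + 1, .cross a)]

/-- `D` and `D'` differ by one local move. -/
def LinkDiagram.MoveRel (D D' : LinkDiagram) : Prop :=
  ∃ w₁ u u' w₂ : List Layer, Move u u' ∧ D.word = w₁ ++ u ++ w₂ ∧ D'.word = w₁ ++ u' ++ w₂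

/-- `Dpos`, `Dzero`, `Dneg` agree except near one place, where they have a positive crossing, the smoothing
that respects the orientations, and a negative crossing. Here `a` and `b` are the orientations of the
two strands below that place. For `a = b` the crossing is positive when the strand from the
lower left lies over, and the smoothing consists of two vertical strands; for `a ≠ b` the
crossing is positive when that strand lies under, and the smoothing is a cap below a cup. -/
def IsSkeinTriple (Dpos Dzero Dneg : LinkDiagram) : Prop :=
  ∃ (w₁ w₂ : List Layer) (l r : List Bool) (a b : Bool),
    Runs [] w₁ (l ++ [a, b] ++ r) ∧
    Dpos.word = w₁ ++ [(l.length, .cross (a == b))] ++ w₂ ∧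
    Dneg.word = w₁ ++ [(l.length, .cross (a != b))] ++ w₂ ∧
    Dzero.word = w₁ ++ (if a = b then [] else [(l.length, .cap), (l.length, .cup b)]) ++ w₂

/-! ### The Homflypt and Conway polynomials -/

/-- The ring `ℤ[v, v⁻¹, z, z⁻¹]`, as Laurent polynomials in `v` over Laurent polynomials in `z`. -/
abbrev LaurentVZ : Type := ℤ[T;T⁻¹][T;T⁻¹]

/-- The variable `v`. -/
def v : LaurentVZ := LaurentPolynomial.T 1

/-- The variable `z`. -/
def z : LaurentVZ := LaurentPolynomial.C (LaurentPolynomial.T 1)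

/-- The relations of the skein module: invariance under the local moves, and the skein relation
`Dpos = v z Dzero + v² Dneg`. -/
def skeinRelations : Submodule LaurentVZ (LinkDiagram →₀ LaurentVZ) :=
  Submodule.span LaurentVZ
    ({x | ∃ D D' : LinkDiagram, D.MoveRel D' ∧
        x = Finsupp.single D 1 - Finsupp.single D' 1} ∪
     {x | ∃ Dpos Dzero Dneg : LinkDiagram, IsSkeinTriple Dpos Dzero Dneg ∧
        x = Finsupp.single Dpos 1 -
          ((v * z) • Finsupp.single Dzero 1 + v ^ 2 • Finsupp.single Dneg 1)})

/-- The Homflypt skein module: the module generated by all link diagrams, subject to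
invariance and the skein relation. -/
abbrev SkeinModule : Type := (LinkDiagram →₀ LaurentVZ) ⧸ skeinRelations

/-- The class of a diagram in the skein module. -/
def LinkDiagram.skeinClass (D : LinkDiagram) : SkeinModule :=
  skeinRelations.mkQ (Finsupp.single D 1)

/-- The diagram of the trivial knot without crossings. -/
def unknot : LinkDiagram where
  word := [(0, .cup true), (0, .cap)]
  runs := .cons (.mk [] [] _ _ _ (.cup true)) (.cons (.mk [] [] _ _ _ (.cap true)) (.nil _))
  nonempty := by simp

/-- The Homflypt polynomial `P_D(v, z)`: the Laurent polynomial to which the skein relation,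
invariance and `P = 1` for the trivial knot evaluate the diagram `D`, that is,
`[D] = P_D • [unknot]` in the skein module. -/
def homflypt (D : LinkDiagram) : LaurentVZ :=
  Classical.epsilon fun f : LaurentVZ => D.skeinClass = f • unknot.skeinClass

/-- The Conway polynomial `∇_D(z) = P_D(1, z)`, in `ℤ[z, z⁻¹]`. -/
def conway (D : LinkDiagram) : ℤ[T;T⁻¹] :=
  LaurentPolynomial.eval₂ (RingHom.id ℤ[T;T⁻¹]) 1 (homflypt D)

/-! ### Closed braids -/

/-- Words in the generators of the braid group on `n` strands: `(i, true)` is `σ_{i+1}`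
and `(i, false)` is its inverse. -/
abbrev BraidWord (n : ℕ) : Type := List (Fin (n - 1) × Bool)

/-- The writhe (exponent sum) of a braid word. -/
def BraidWord.writhe {n : ℕ} (β : BraidWord n) : ℤ :=
  (β.map fun g => if g.2 then (1 : ℤ) else -1).sum

/-- The layers of the standard closure: `n` nested minima, the braid on the `n` left strands, which
are oriented upwards, and `n` nested maxima. The generator `σ_i` is a positive crossing. -/
def BraidWord.closureWord {n : ℕ} (β : BraidWord n) : List Layer :=
  (List.range n).map (fun i => (i, Piece.cup true)) ++
    β.map (fun g => ((g.1 : ℕ), Piece.cross g.2)) ++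
    (List.range n).reverse.map (fun i => (i, Piece.cap))

theorem Runs.append {s t u : List Bool} {w w' : List Layer} (h : Runs s w t) (h' : Runs t w' u) :
    Runs s (w ++ w') u := by
  induction h with
  | nil => exact h'
  | cons hs _ ih => exact .cons hs (ih h')

theorem runs_cups (n : ℕ) : Runs [] ((List.range n).map (fun i => (i, Piece.cup true)))
    (List.replicate n true ++ List.replicate n false) := by
  induction n with
  | zero => exact .nil _
  | succ n ih =>
    rw [List.range_succ, List.map_append]
    refine ih.append (.cons ?_ (.nil _))
    have h := Step.mk (List.replicate n true) (List.replicate n false) _ _ _ (Piece.Joins.cup true)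
    rw [List.replicate_succ' (n := n) (a := true), List.replicate_succ (n := n) (a := false)]
    simpa using h

theorem runs_caps (n : ℕ) : Runs (List.replicate n true ++ List.replicate n false)
    ((List.range n).reverse.map (fun i => (i, Piece.cap))) [] := by
  induction n with
  | zero => exact .nil _
  | succ n ih =>
    rw [List.range_succ, List.reverse_append, List.map_append]
    refine Runs.append (.cons ?_ (.nil _)) ih
    have h := Step.mk (List.replicate n true) (List.replicate n false) _ _ _ (Piece.Joins.cap true)
    rw [List.replicate_succ' (n := n) (a := true), List.replicate_succ (n := n) (a := false)]
    simpa using h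

theorem runs_braid {n : ℕ} (β : BraidWord n) :
    Runs (List.replicate n true ++ List.replicate n false)
      (β.map (fun g => ((g.1 : ℕ), Piece.cross g.2)))
      (List.replicate n true ++ List.replicate n false) := by
  induction β with
  | nil => exact .nil _
  | cons g β ih =>
    refine .cons ?_ ih
    obtain ⟨⟨i, hi⟩, ε⟩ := g
    have h := Step.mk (List.replicate i true)
      (List.replicate (n - 2 - i) true ++ List.replicate n false) _ _ _
      (Piece.Joins.cross ε true true)
    have e : List.replicate n true =
        List.replicate i true ++ [true, true] ++ List.replicate (n - 2 - i) true := by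
      rw [show [true, true] = List.replicate 2 true from rfl, ← List.replicate_add,
        ← List.replicate_add]
      congr 1
      omega
    rw [e]
    simpa using h

/-- The standard closure of a braid. -/
def BraidWord.closure {n : ℕ} [NeZero n] (β : BraidWord n) : LinkDiagram where
  word := β.closureWord
  runs := ((runs_cups n).append (runs_braid β)).append (runs_caps n)
  nonempty := by
    intro h
    have := NeZero.ne n
    simp_all [BraidWord.closureWord]

/-- The power `σ_1 ^ p` in the braid group on two strands. -/
def twist (p : ℤ) : BraidWord 2 := List.replicate p.natAbs (0, decide (0 ≤ p))

/-- `C_p(z)`, the Conway polynomial of the elementary torus link with two strands and `p` twists. -/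
def torusConway (p : ℤ) : ℤ[T;T⁻¹] := conway (twist p).closure

/-- The polynomials `p_0, …, p_{n-1} ∈ ℤ[z]` are the coefficients of the standard form of the
Homflypt polynomial of the closed braid:
`P(v, z) = v ^ w (∑ j, p_j(z) v ^ (2 j)) / (v z) ^ (n - 1)`, where `v z` is a unit. -/
def IsStandardForm {n : ℕ} [NeZero n] (β : BraidWord n) (p : Fin n → ℤ[X]) : Prop :=
  homflypt β.closure * (v * z) ^ (n - 1) =
    LaurentPolynomial.T β.writhe *
      ∑ j : Fin n, LaurentPolynomial.C (Polynomial.toLaurent (p j)) * v ^ (2 * (j : ℕ))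

end Homflypt

end

/-! After multiplication by `v ^ (-w)` the skein relation becomes the Hecke relation `σ = z + σ⁻¹`,
in which `v` no longer occurs. Hence each word `β` in `B_3` reduces to the six positive permutation
braids with coefficients in `ℤ[z]`. For a function with the values of a conjugation invariant one,
these six collapse to `1`, `σ₁`, `σ₁σ₂`: there are `a, b, c ∈ ℤ[z]`, depending on `β` alone, with `F
β = a F(1) + b F(σ₁) + c F(σ₁σ₂)` for every such `F` (`exists_trace_coeff`).

Three functions are inserted. The normalised skein class of the closure has the values `δ²`, `v⁻¹δ`,
`v⁻²` times the class of the unknot, where `vzδ = 1 - v²`; this yields `P (vz)² = v^w (a(1 - v²)² +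
bz(1 - v²) + cz²)`. At `v = 1` one has `δ = 0`, so `∇ = c`. The functions `C_{w+1}` and `C_{w-1}` of
the writhe also qualify, because `C_p` obeys the recursion `C_{p+1} = z C_p + C_{p-1}`; they yield
`a + zb + (z² + 1)c` and `a + c`. So `a`, `zb`, `c` are known from `w` and `∇`, and expansion in
powers of `v²` gives the three coefficients.

The long part is that `P` is well defined. It is chosen by `Classical.epsilon`, so the unknot has to
generate a free submodule of the skein module (`eq_zero_of_smul_unknot`). This needs an invariant
that is nonzero on the unknot: the `gl_N` state sum, which satisfies the skein relation with `v =
q^(-N)`, `z = q - q⁻¹`. Crossings that are not upward are rotations of the upward one, compensated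
by cap weights. Infinitely many `q`, and infinitely many `N` for each `q`, detect every Laurent
polynomial in `v` and `z`. -/

noncomputable section

namespace Homflypt

/-! ### The `gl_N` state model

The strands are coloured by `Fin N`; a labelled section is a list of orientations and colours. -/

namespace StateModel

/-- Weight of an upward crossing whose strands keep their colours `i`, `j`. -/
def through {N : ℕ} (q : ℝ) : Bool → Fin N → Fin N → ℝ
  | true, i, j => (q ^ N)⁻¹ * if i = j then q else 1
  | false, i, j => q ^ N * if i = j then q⁻¹ else 1

/-- Weight of an upward crossing whose colours `i`, `j` follow the smoothing. -/
def turn {N : ℕ} (q : ℝ) : Bool → Fin N → Fin N → ℝ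
  | true, i, j => if i < j then (q ^ N)⁻¹ * (q - q⁻¹) else 0
  | false, i, j => if j < i then -(q ^ N * (q - q⁻¹)) else 0

/-- The `R`-matrix: the weight of an upward crossing with colours `i`, `j` at the bottom and `k`, `l`
at the top. -/
def upCrossing {N : ℕ} (q : ℝ) (ε : Bool) (i j k l : Fin N) : ℝ :=
  (if k = j ∧ l = i then through q ε i j else 0) + if k = i ∧ l = j then turn q ε i j else 0

/-- The pivotal weights `q^(2i+1-N)`, put entirely on one orientation of a maximum; their sum over
the colours is the value of a circle. Minima receive the inverse weights so that zigzags cancel. -/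
def capWeight {N : ℕ} (q : ℝ) : Bool → Fin N → ℝ
  | true, i => q ^ (2 * (i : ℕ) + 1) * (q ^ N)⁻¹
  | false, _ => 1

def cupWeight {N : ℕ} (q : ℝ) (o : Bool) (i : Fin N) : ℝ := (capWeight q (!o) i)⁻¹

/-- The weight of a crossing with bottom orientations `a`, `b`. -/
def crossing {N : ℕ} (q : ℝ) (ε : Bool) : Bool → Bool → Fin N → Fin N → Fin N → Fin N → ℝ
  | true, true, i, j, k, l => upCrossing q ε i j k l
  | false, true, i, j, k, l => upCrossing q (!ε) j l i k
  | false, false, i, j, k, l => upCrossing q ε l k j i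
  | true, false, i, j, k, l => capWeight q true i / capWeight q true l * upCrossing q (!ε) k i l j

/-! ### Identities for the local weights -/

section weights

variable {N : ℕ} {q : ℝ}

theorem capWeight_ne_zero (hq : q ≠ 0) (a : Bool) (i : Fin N) : capWeight q a i ≠ 0 := by
  cases a <;> simp [capWeight, hq]

/-- Reversing the order of the colours inverts the cap weights and, by `turn_rev`, swaps the
arguments of `turn`. Each identity with inverse cap weights thereby gives its mirror image with cap
weights. -/
theorem capWeight_rev (hq : q ≠ 0) (i : Fin N) :
    capWeight q true i.rev = (capWeight q true i)⁻¹ := by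
  have h : q ^ (2 * (i.rev : ℕ) + 1) * q ^ (2 * (i : ℕ) + 1) = q ^ N * q ^ N := by
    rw [← pow_add, ← pow_add, Fin.val_rev]; congr 1; omega
  have := pow_ne_zero N hq
  simp only [capWeight]
  rw [mul_inv, inv_inv, ← div_eq_mul_inv, div_eq_iff this, eq_comm, mul_assoc, ← h, mul_comm,
    mul_assoc, mul_inv_cancel₀ (pow_ne_zero _ hq), mul_one]

theorem turn_rev (ε : Bool) (i j : Fin N) : turn q ε i.rev j.rev = turn q ε j i := by
  cases ε <;> simp [turn, Fin.rev_lt_rev]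

theorem through_rev (ε : Bool) (i j : Fin N) : through q ε i.rev j.rev = through q ε i j := by
  cases ε <;> simp [through]

theorem turn_self (ε : Bool) (i : Fin N) : turn q ε i i = 0 := by
  cases ε <;> simp [turn]

theorem through_mul_through (hq : q ≠ 0) (ε : Bool) (i j : Fin N) :
    through q ε i j * through q (!ε) j i = 1 := by
  by_cases h : i = j
  · subst h; cases ε <;> simp [through] <;> field_simp
  · have h' : j ≠ i := Ne.symm h
    cases ε <;> simp [through, h, h', hq]

/-- A nonzero weight forces the colours at the top to be those at the bottom, up to order, and then
the factor in front equals one. -/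
theorem upCrossing_conserves (hq : q ≠ 0) (ε : Bool) (i j k l : Fin N) :
    capWeight q true i / capWeight q true l * (capWeight q true j / capWeight q true k) *
      upCrossing q ε i j k l = upCrossing q ε i j k l := by
  have h := fun i : Fin N => capWeight_ne_zero hq true i
  unfold upCrossing
  by_cases h1 : k = j ∧ l = i
  · obtain ⟨rfl, rfl⟩ := h1; simp [h]
  · by_cases h2 : k = i ∧ l = j
    · obtain ⟨rfl, rfl⟩ := h2
      rw [div_mul_div_comm, mul_comm (capWeight q true l), div_self (mul_ne_zero (h _) (h _)),
        one_mul]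
    · simp [h1, h2]

theorem sum_telescope (g : ℕ → ℝ) {a b : ℕ} (hab : a ≤ b) (hb : b ≤ N) :
    ∑ p : Fin N, (if a ≤ (p : ℕ) ∧ (p : ℕ) < b then g p - g (p + 1) else 0) = g a - g b := by
  rw [Fin.sum_univ_eq_sum_range (fun p => if a ≤ p ∧ p < b then g p - g (p + 1) else 0),
    ← Finset.sum_filter]
  have : (Finset.range N).filter (fun p => a ≤ p ∧ p < b) = Finset.Ico a b := by
    ext p; simp; omega
  rw [this]
  have := Finset.sum_Ico_sub g hab
  rw [← neg_sub, ← this, ← Finset.sum_neg_distrib]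
  simp

/-- The telescoping step for the geometric sequence of weights. -/
theorem inv_capWeight_mul (hq : q ≠ 0) (p : Fin N) :
    (capWeight q true p)⁻¹ * (q - q⁻¹) =
      q ^ N * (q⁻¹) ^ (2 * (p : ℕ)) - q ^ N * (q⁻¹) ^ (2 * ((p : ℕ) + 1)) := by
  simp only [capWeight, mul_add, pow_add, inv_pow, mul_inv, inv_inv]
  field_simp
  ring

/-- The partial trace of the `R`-matrix is the identity, which is the first Reidemeister move. The
sum over `i` telescopes, and the normalisation by `q^(∓N)` is the one that makes the total
independent of `k`. -/
theorem sum_inv_capWeight_mul_turn (hq : q ≠ 0) (ε : Bool) (k : Fin N) :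
    (capWeight q true k)⁻¹ * through q ε k k +
      ∑ i : Fin N, (capWeight q true i)⁻¹ * turn q ε i k = 1 := by
  have hN := pow_ne_zero N hq
  cases ε
  · have h := sum_telescope (fun p => q ^ N * (q⁻¹) ^ (2 * p)) (N := N) k.2 le_rfl
    simp_rw [← inv_capWeight_mul hq] at h
    have : ∀ i : Fin N, (capWeight q true i)⁻¹ * turn q false i k =
        -q ^ N * if (k : ℕ).succ ≤ i ∧ (i : ℕ) < N then
          (capWeight q true i)⁻¹ * (q - q⁻¹) else 0 := by
      intro i
      simp only [turn, Fin.lt_def, Nat.succ_le_iff, i.2, and_true]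
      split_ifs <;> ring
    simp_rw [this, ← Finset.mul_sum, h]
    simp only [capWeight, through, mul_add, pow_add, inv_pow, mul_inv, inv_inv, pow_mul, if_true,
      Nat.succ_eq_add_one]
    field_simp
    ring
  · have h := sum_telescope (fun p => q ^ N * (q⁻¹) ^ (2 * p)) (N := N) (Nat.zero_le k) k.2.le
    simp_rw [← inv_capWeight_mul hq] at h
    have : ∀ i : Fin N, (capWeight q true i)⁻¹ * turn q true i k =
        (q ^ N)⁻¹ * if 0 ≤ (i : ℕ) ∧ (i : ℕ) < k then
          (capWeight q true i)⁻¹ * (q - q⁻¹) else 0 := by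
      intro i
      simp only [turn, Fin.lt_def, Nat.zero_le, true_and]
      split_ifs <;> ring
    simp_rw [this, ← Finset.mul_sum, h]
    simp only [capWeight, through, pow_add, inv_pow, mul_inv, inv_inv, pow_mul, if_true]
    field_simp
    ring

/-- The unwanted terms of the second Reidemeister move on antiparallel strands cancel: both turns
are nonzero only for `p` strictly between `i` and `l`, and the sum over this interval telescopes
against the two boundary terms. -/
theorem sum_inv_capWeight_mul_turn_mul_turn (hq : q ≠ 0) (ε : Bool) (i l : Fin N) :
    (capWeight q true i)⁻¹ * through q (!ε) i i * turn q ε i l +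
      (capWeight q true l)⁻¹ * turn q (!ε) l i * through q ε l l +
      ∑ p : Fin N, (capWeight q true p)⁻¹ * turn q (!ε) p i * turn q ε p l = 0 := by
  have hN := pow_ne_zero N hq
  have key : ∀ a b : Fin N, a < b →
      ∑ p : Fin N, (if (a : ℕ).succ ≤ p ∧ (p : ℕ) < b then
          (capWeight q true p)⁻¹ * (q - q⁻¹) else 0) =
        q ^ N * (q⁻¹) ^ (2 * ((a : ℕ) + 1)) - q ^ N * (q⁻¹) ^ (2 * (b : ℕ)) := by
    intro a b h
    have := sum_telescope (fun p => q ^ N * (q⁻¹) ^ (2 * p)) (N := N)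
      (Nat.succ_le_of_lt (Fin.lt_def.1 h)) b.2.le
    simp_rw [← inv_capWeight_mul hq] at this
    exact this
  have sums : ∀ a b : Fin N, ∑ p : Fin N, (capWeight q true p)⁻¹ *
      (turn q true p b * turn q false p a) = -(q - q⁻¹) *
      ∑ p : Fin N, (if (a : ℕ).succ ≤ p ∧ (p : ℕ) < b then
          (capWeight q true p)⁻¹ * (q - q⁻¹) else 0) := by
    intro a b
    rw [Finset.mul_sum]
    refine Finset.sum_congr rfl fun p _ => ?_
    simp only [turn, Fin.lt_def, Nat.succ_le_iff]
    split_ifs <;> first | omega | skip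
    all_goals field_simp
    all_goals simp
  have zero : ∀ a b : Fin N, ¬ a < b → ∑ p : Fin N, (capWeight q true p)⁻¹ *
      (turn q true p b * turn q false p a) = 0 := by
    intro a b h
    refine Finset.sum_eq_zero fun p _ => ?_
    simp only [turn, Fin.lt_def] at h ⊢
    split_ifs <;> first | omega | simp
  cases ε
  · simp only [Bool.not_false, mul_assoc]
    by_cases h : l < i
    · rw [sums, key _ _ h]
      simp only [turn, through, if_pos h, if_true, capWeight, mul_add, pow_add, inv_pow, mul_inv,
        inv_inv, pow_mul]
      field_simp
      ring
    · rw [zero _ _ h]; simp [turn, h]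
  · simp only [Bool.not_true, mul_assoc]
    simp only [mul_comm (turn q false _ _) (turn q true _ _)]
    by_cases h : i < l
    · rw [sums, key _ _ h]
      simp only [turn, through, if_pos h, if_true, capWeight, mul_add, pow_add, inv_pow, mul_inv,
        inv_inv, pow_mul]
      field_simp
      ring
    · rw [zero _ _ h]; simp [turn, h]

theorem sum_capWeight_mul_turn (hq : q ≠ 0) (ε : Bool) (k : Fin N) :
    capWeight q true k * through q ε k k +
      ∑ i : Fin N, capWeight q true i * turn q ε k i = 1 := by
  have h := sum_inv_capWeight_mul_turn hq ε k.rev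
  rw [← Equiv.sum_comp Fin.revPerm] at h
  simpa [capWeight_rev hq, turn_rev, through_rev] using h

theorem sum_capWeight_mul_turn_mul_turn (hq : q ≠ 0) (ε : Bool) (i l : Fin N) :
    capWeight q true i * through q (!ε) i i * turn q ε l i +
      capWeight q true l * turn q (!ε) i l * through q ε l l +
      ∑ p : Fin N, capWeight q true p * turn q (!ε) i p * turn q ε l p = 0 := by
  have h := sum_inv_capWeight_mul_turn_mul_turn hq ε i.rev l.rev
  rw [← Equiv.sum_comp Fin.revPerm] at h
  simpa [capWeight_rev hq, turn_rev, through_rev] using h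

theorem turn_mul_through (hq : q ≠ 0) (ε : Bool) (i j : Fin N) :
    turn q ε i j * through q (!ε) i j + through q ε i j * turn q (!ε) j i = 0 := by
  have := pow_ne_zero N hq
  rcases lt_trichotomy i j with h | h | h
  · cases ε <;> simp [turn, through, h, h.ne, h.not_gt]
    all_goals field_simp; ring
  · subst h; simp [turn_self]
  · cases ε <;> simp [turn, through, h, h.ne', h.not_gt]
    all_goals field_simp; ring

theorem turn_mul_turn (ε : Bool) (i j : Fin N) : turn q ε i j * turn q (!ε) i j = 0 := by
  rcases lt_trichotomy i j with h | h | h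
  · cases ε <;> simp [turn, h, h.not_gt]
  · subst h; simp [turn_self]
  · cases ε <;> simp [turn, h, h.not_gt]

/-- An upward crossing followed by the opposite one. -/
theorem upCrossing_inverse (hq : q ≠ 0) (ε : Bool) (i j k l : Fin N) :
    ∑ p : Fin N, ∑ r : Fin N, upCrossing q ε i j p r * upCrossing q (!ε) p r k l =
      if i = k ∧ j = l then 1 else 0 := by
  have h1 := through_mul_through (N := N) hq ε
  have h2 := turn_mul_through (N := N) hq ε
  have h3 := turn_mul_turn (N := N) (q := q) ε
  simp only [upCrossing, ite_and, add_mul, mul_add, Finset.sum_add_distrib, ite_mul, mul_ite,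
    zero_mul, mul_zero, Finset.sum_ite_eq, Finset.sum_ite_eq', Finset.mem_univ, if_true,
    Finset.sum_ite_irrel, Finset.sum_const_zero]
  have h1' := h1 i j
  have h2' := h2 i j
  have h3' := h3 i j
  split_ifs <;> subst_vars <;> simp_all [turn_self]

/-- Parallel strands reduce to `upCrossing_inverse`. For antiparallel strands an intermediate colour
circulates, and the weighted sums of products of two turns are needed. -/
theorem crossing_inverse (hq : q ≠ 0) (ε a b : Bool) (i j k l : Fin N) :
    ∑ p : Fin N, ∑ r : Fin N, crossing q ε b a i j p r * crossing q (!ε) a b p r k l =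
      if i = k ∧ j = l then 1 else 0 := by
  have hc := fun i : Fin N => capWeight_ne_zero hq true i
  have h1 := through_mul_through (N := N) hq ε
  cases a <;> cases b
  · simp only [crossing]
    have := upCrossing_inverse hq (!ε) l k j i
    rw [Finset.sum_comm]
    simp only [Bool.not_not] at this
    simp only [mul_comm (upCrossing q ε _ _ _ _), this]
    simp only [and_comm, eq_comm]
  · simp only [crossing, Bool.not_not, upCrossing, ite_and, add_mul, mul_add,
      Finset.sum_add_distrib, ite_mul, mul_ite,
      zero_mul, mul_zero, Finset.sum_ite_eq, Finset.sum_ite_eq', Finset.mem_univ, if_true,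
      Finset.sum_ite_irrel, Finset.sum_const_zero]
    have hs := sum_inv_capWeight_mul_turn_mul_turn hq ε i l
    have hsum : ∑ x, capWeight q true i / capWeight q true x * turn q (!ε) x i * turn q ε x l =
        capWeight q true i *
          ∑ x, (capWeight q true x)⁻¹ * turn q (!ε) x i * turn q ε x l := by
      rw [Finset.mul_sum]; exact Finset.sum_congr rfl fun x _ => by ring
    rw [hsum, eq_neg_of_add_eq_zero_right hs]
    have h1' := h1 i l
    by_cases hij : j = i
    · subst hij
      by_cases hkl : k = l
      · subst hkl
        by_cases hjk : j = k
        · subst hjk; simp [turn_self, hc]; linarith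
        · have := hc j; have := hc k
          simp [hjk, Ne.symm hjk]; field_simp; ring
      · by_cases hjk : j = k
        · subst hjk; simp [hkl]
        · simp [hkl, hjk, Ne.symm hjk]
    · by_cases hki : k = i
      · subst hki
        by_cases hjl : j = l
        · subst hjl; simp [hij, hc]; linarith
        · simp [hij, hjl]
      · simp [hij, hki, Ne.symm hki]
  · simp only [crossing, Bool.not_not, upCrossing, ite_and, add_mul, mul_add,
      Finset.sum_add_distrib, ite_mul, mul_ite,
      zero_mul, mul_zero, Finset.sum_ite_eq, Finset.sum_ite_eq', Finset.mem_univ, if_true,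
      Finset.sum_ite_irrel, Finset.sum_const_zero]
    have hs := sum_capWeight_mul_turn_mul_turn hq ε i k
    have hsum : ∑ x, turn q (!ε) j x * (capWeight q true x / capWeight q true l * turn q ε k x) =
        (capWeight q true l)⁻¹ *
          ∑ x, capWeight q true x * turn q (!ε) j x * turn q ε k x := by
      rw [Finset.mul_sum]; exact Finset.sum_congr rfl fun x _ => by ring
    rw [hsum]
    have h1' := h1 k l
    by_cases hij : i = j
    · subst hij
      rw [eq_neg_of_add_eq_zero_right hs]
      by_cases hkl : l = k
      · subst hkl
        by_cases hjk : i = l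
        · subst hjk; simp [turn_self, hc]; linarith
        · have := hc i; have := hc l
          simp [hjk, Ne.symm hjk]; field_simp; ring
      · by_cases hjk : i = k
        · subst hjk; simp [hkl, Ne.symm hkl]
        · simp [hkl, hjk, Ne.symm hjk]
    · by_cases hki : i = k
      · subst hki
        by_cases hjl : l = j
        · subst hjl; simp [hij, hc]; linarith
        · simp [hij, hjl, Ne.symm hjl]
      · simp [hij, hki]
  · exact upCrossing_inverse hq ε i j k l

/-- A curl at a minimum is a partial trace of a rotated crossing; for `k ≠ l` conservation of
colours kills every term. -/
theorem sum_crossing_mul_cupWeight (hq : q ≠ 0) (ε o : Bool) (k l : Fin N) :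
    ∑ i : Fin N, crossing q ε o (!o) i i k l * cupWeight q o i =
      if k = l then cupWeight q (!o) k else 0 := by
  have hc := fun i : Fin N => capWeight_ne_zero hq true i
  cases o
  · change ∑ i, upCrossing q (!ε) i l i k * (capWeight q true i)⁻¹ =
      if k = l then (capWeight q false k)⁻¹ else 0
    have hs := sum_inv_capWeight_mul_turn hq (!ε) l
    by_cases hkl : k = l
    · subst hkl
      simp [upCrossing, ite_and, add_mul, Finset.sum_add_distrib, capWeight] at hs ⊢
      rw [← hs, mul_comm]; simp [mul_comm]
    · have : ∀ i, ¬ (i = l ∧ k = i) := by rintro i ⟨rfl, rfl⟩; exact hkl rfl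
      simp [upCrossing, hkl, this]
  · change ∑ i, capWeight q true i / capWeight q true l * upCrossing q (!ε) k i l i *
      (capWeight q false i)⁻¹ = if k = l then (capWeight q true k)⁻¹ else 0
    have hs := sum_capWeight_mul_turn hq (!ε) l
    by_cases hkl : k = l
    · subst hkl
      rw [if_pos rfl, ← mul_one (capWeight q true k)⁻¹, ← hs, mul_add, Finset.mul_sum]
      have : ∀ i, capWeight q true i / capWeight q true k * upCrossing q (!ε) k i k i *
          (capWeight q false i)⁻¹ = (if i = k then through q (!ε) k k else 0) +
          (capWeight q true k)⁻¹ * (capWeight q true i * turn q (!ε) k i) := by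
        intro i
        rw [show capWeight q false i = 1 from rfl]
        by_cases h : i = k
        · subst h; simp [upCrossing, turn_self, hc]
        · simp [upCrossing, h, Ne.symm h]; ring
      simp_rw [this, Finset.sum_add_distrib]
      have := hc k
      simp; field_simp
    · have : ∀ i, ¬ (l = i ∧ i = k) := by rintro i ⟨rfl, rfl⟩; exact hkl rfl
      simp [upCrossing, hkl, this, Ne.symm hkl]

theorem sum_capWeight_mul_crossing (hq : q ≠ 0) (ε a : Bool) (i j : Fin N) :
    ∑ k : Fin N, capWeight q (!a) k * crossing q ε a (!a) i j k k =
      if i = j then capWeight q a i else 0 := by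
  have hc := fun i : Fin N => capWeight_ne_zero hq true i
  cases a
  · change ∑ k, capWeight q true k * upCrossing q (!ε) j k i k =
      if i = j then (1 : ℝ) else 0
    have hs := sum_capWeight_mul_turn hq (!ε) i
    by_cases hij : i = j
    · subst hij
      simp [upCrossing, ite_and, mul_add, Finset.sum_add_distrib] at hs ⊢
      exact hs
    · have : ∀ k, ¬ (i = k ∧ k = j) := by rintro i ⟨rfl, rfl⟩; exact hij rfl
      simp [upCrossing, hij, this]
  · change ∑ k, 1 * (capWeight q true i / capWeight q true k * upCrossing q (!ε) k i k j) =
      if i = j then capWeight q true i else 0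
    have hs := sum_inv_capWeight_mul_turn hq (!ε) i
    by_cases hij : i = j
    · subst hij
      rw [if_pos rfl]
      conv_rhs => rw [← mul_one (capWeight q true i), ← hs, mul_add, Finset.mul_sum]
      have : ∀ k, 1 * (capWeight q true i / capWeight q true k * upCrossing q (!ε) k i k i) =
          (if k = i then through q (!ε) i i else 0) +
          capWeight q true i * ((capWeight q true k)⁻¹ * turn q (!ε) k i) := by
        intro k
        by_cases h : k = i
        · subst h; simp [upCrossing, turn_self, hc]
        · simp [upCrossing, h, Ne.symm h]; ring
      simp_rw [this, Finset.sum_add_distrib]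
      have := hc i
      simp; field_simp
    · have : ∀ k, ¬ (k = i ∧ j = k) := by rintro k ⟨rfl, rfl⟩; exact hij rfl
      simp [upCrossing, hij, Ne.symm hij, this]

/-- A quarter turn takes a crossing to the opposite crossing. -/
theorem capWeight_mul_crossing (hq : q ≠ 0) (ε a b : Bool) (i j k l : Fin N) :
    capWeight q a l * crossing q ε a b i j k l =
      capWeight q a i * crossing q (!ε) b (!a) j l i k := by
  have hc := fun i : Fin N => capWeight_ne_zero hq true i
  have h1 : ∀ i : Fin N, capWeight q false i = 1 := fun _ => rfl
  have := hc l
  cases a <;> cases b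
  · simp [crossing, h1]
  · simp [crossing, h1]
  · simp only [crossing, Bool.not_true, Bool.not_not]; field_simp
  · have h := upCrossing_conserves hq ε i j k l
    have := hc k
    simp only [crossing, Bool.not_true, Bool.not_not]
    conv_lhs => rw [← h]
    field_simp

theorem crossing_mul_cupWeight (hq : q ≠ 0) (ε a b : Bool) (i j k l : Fin N) :
    crossing q ε b a i l j k * cupWeight q a l =
      crossing q (!ε) (!a) b j i k l * cupWeight q a j := by
  have h := capWeight_mul_crossing hq (!ε) (!a) b j i k l
  have h1 := capWeight_ne_zero hq (!a) l
  have h2 := capWeight_ne_zero hq (!a) j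
  simp only [Bool.not_not] at h
  simp only [cupWeight]
  field_simp
  linarith

/-- The Hecke relation of the `R`-matrix: `(q^N)⁻¹` plays the role of `v` and `q - q⁻¹` that of `z`.
-/
theorem upCrossing_skein (hq : q ≠ 0) (i j k l : Fin N) :
    upCrossing q true i j k l =
      (q ^ N)⁻¹ * (q - q⁻¹) * (if k = i ∧ l = j then 1 else 0) +
        ((q ^ N)⁻¹) ^ 2 * upCrossing q false i j k l := by
  have := pow_ne_zero N hq
  unfold upCrossing
  rcases lt_trichotomy i j with h | h | h
  · simp [through, turn, h, h.ne, h.not_gt]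
    split_ifs <;> field_simp <;> ring
  · subst h
    simp [through, turn]
    split_ifs <;> field_simp <;> ring
  · simp [through, turn, h, h.ne', h.not_gt]
    split_ifs <;> field_simp <;> ring

/-- Rotation of `upCrossing_skein`. On antiparallel strands a quarter turn exchanges positive and
negative weights and takes the two vertical strands to a cap below a cup. -/
theorem crossing_skein (hq : q ≠ 0) (a b : Bool) (i j k l : Fin N) :
    crossing q (a == b) a b i j k l =
      (q ^ N)⁻¹ * (q - q⁻¹) * (if a = b then (if i = k ∧ j = l then 1 else 0) else
        if i = j ∧ k = l then capWeight q a i * cupWeight q b k else 0) +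
      ((q ^ N)⁻¹) ^ 2 * crossing q (a != b) a b i j k l := by
  cases a <;> cases b
  · have h := upCrossing_skein hq l k j i
    simp only [crossing, beq_self_eq_true, bne_self_eq_false, if_true, h]
    congr 3
    simp only [and_comm]
  · have h := upCrossing_skein hq j l i k
    have e1 : (false == true) = false := rfl
    have e2 : (false != true) = true := rfl
    simp only [crossing, e1, e2, Bool.not_false, Bool.not_true, h]
    congr 2
    simp [capWeight, cupWeight]
  · have h := upCrossing_skein hq k i l j
    have e1 : (true == false) = false := rfl
    have e2 : (true != false) = true := rfl
    simp only [crossing, e1, e2, Bool.not_false, Bool.not_true, h, cupWeight, mul_add]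
    congr 1
    · by_cases h : i = j ∧ k = l
      · obtain ⟨rfl, rfl⟩ := h; simp; ring
      · rw [if_neg h, if_neg fun h' => h ⟨h'.2.symm, h'.1.symm⟩]; simp
    · ring
  · have h := upCrossing_skein hq i j k l
    simp only [crossing, beq_self_eq_true, bne_self_eq_false, if_true, h]
    congr 3
    simp only [eq_comm]

theorem sum_upCrossing_mul (ε : Bool) (k l : Fin N) (φ : Fin N → Fin N → ℝ) :
    ∑ i, ∑ j, upCrossing q ε i j k l * φ i j =
      through q ε l k * φ l k + turn q ε k l * φ k l := by
  simp [upCrossing, ite_and, add_mul, Finset.sum_add_distrib]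

end weights

end StateModel

/-! ### Orientations along a diagram -/

/-- The section above the layer `(i, p)`, if that layer fits. -/
def next : ℕ → Piece → List Bool → Option (List Bool)
  | 0, .cup o, s => some (o :: (!o) :: s)
  | 0, .cap, a :: b :: s => if b = !a then some s else none
  | 0, .cross _, a :: b :: s => some (b :: a :: s)
  | i + 1, p, a :: s => (next i p s).map (a :: ·)
  | _, _, _ => none

/-- The section above a sequence of layers. -/
def run : List Layer → List Bool → Option (List Bool)
  | [], s => some s
  | ℓ :: w, s => (next ℓ.1 ℓ.2 s).bind (run w)

/-- Layers act deterministically on sections, so the inductive relations can be replaced by a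
computable function and concrete diagrams checked by `rfl`. -/
theorem step_iff_next {s t : List Bool} {i : ℕ} {p : Piece} :
    Step s (i, p) t ↔ next i p s = some t := by
  constructor
  · generalize hℓ : (i, p) = ℓ
    rintro ⟨l, r, x, y, p', h⟩
    obtain ⟨rfl, rfl⟩ := Prod.mk.inj hℓ
    induction l with
    | nil => cases h <;> simp [next]
    | cons a l ih => simpa [next] using ih rfl
  · induction i generalizing s t with
    | zero =>
      intro h
      rcases p with o | _ | ε
      · simp only [next, Option.some.injEq] at h
        subst h
        exact Step.mk [] s _ _ _ (.cup o)
      · rcases s with _ | ⟨a, _ | ⟨b, s⟩⟩ <;> simp [next] at h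
        obtain ⟨rfl, rfl⟩ := h
        exact Step.mk [] s _ _ _ (.cap a)
      · rcases s with _ | ⟨a, _ | ⟨b, s⟩⟩ <;> simp [next] at h
        subst h
        exact Step.mk [] s _ _ _ (.cross ε a b)
    | succ i ih =>
      intro h
      rcases s with _ | ⟨a, s⟩ <;> simp [next] at h
      obtain ⟨t, h, rfl⟩ := h
      generalize hℓ : (i, p) = ℓ at ih
      obtain ⟨l, r, x, y, p', hp⟩ := ih h
      obtain ⟨rfl, rfl⟩ := Prod.mk.inj hℓ
      exact Step.mk (a :: l) r x y p hp

theorem runs_iff_run {s t : List Bool} {w : List Layer} : Runs s w t ↔ run w s = some t := by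
  constructor
  · intro h
    induction h with
    | nil => rfl
    | cons h _ ih => simpa [run, step_iff_next.1 h] using ih
  · induction w generalizing s with
    | nil => intro h; cases h; exact .nil _
    | cons ℓ w ih =>
      intro h
      obtain ⟨u, hu, h⟩ := Option.bind_eq_some_iff.1 h
      exact .cons (step_iff_next.2 hu) (ih h)

theorem run_append (u w : List Layer) (s : List Bool) :
    run (u ++ w) s = (run u s).bind (run w) := by
  induction u generalizing s with
  | nil => rfl
  | cons ℓ u ih => simp only [List.cons_append, run, ih, Option.bind_assoc]

/-- The layers with one more strand on the left. -/
def shift (u : List Layer) : List Layer := u.map fun ℓ => (ℓ.1 + 1, ℓ.2)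

theorem run_shift_cons (u : List Layer) (a : Bool) (s : List Bool) :
    run (shift u) (a :: s) = (run u s).map (a :: ·) := by
  induction u generalizing s with
  | nil => rfl
  | cons ℓ u ih =>
    change (Option.map (a :: ·) (next ℓ.1 ℓ.2 s)).bind (run (shift u)) = _
    simp only [run]
    cases next ℓ.1 ℓ.2 s with
    | none => rfl
    | some t => exact ih t

theorem run_shift_nil {u : List Layer} (hu : u ≠ []) : run (shift u) [] = none := by
  cases u with
  | nil => exact absurd rfl hu
  | cons ℓ u => rfl

namespace StateModel

/-! ### The action of the layers -/

/-- A vector assigns a number to each labelled section. -/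
abbrev Vector (N : ℕ) : Type := List (Bool × Fin N) → ℝ

variable {N : ℕ} (q : ℝ)

/-- The action of a piece at the left end. -/
def pieceAct : Piece → Vector N → Vector N
  | .cup o, ψ, x :: y :: m =>
    if x.1 = o ∧ y.1 = (!o) ∧ x.2 = y.2 then cupWeight q o x.2 * ψ m else 0
  | .cap, ψ, m => ∑ a : Bool, ∑ i : Fin N, capWeight q a i * ψ ((a, i) :: (!a, i) :: m)
  | .cross ε, ψ, x :: y :: m =>
    ∑ i : Fin N, ∑ j : Fin N, crossing q ε y.1 x.1 i j x.2 y.2 * ψ ((y.1, i) :: (x.1, j) :: m)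
  | _, _, _ => 0

/-- The action of the layer `(i, p)`. -/
def layerAct : ℕ → Piece → Vector N → Vector N
  | 0, p, ψ, m => pieceAct q p ψ m
  | i + 1, p, ψ, x :: m => layerAct i p (fun m' => ψ (x :: m')) m
  | _ + 1, _, _, [] => 0

def wordAct : List Layer → Vector N → Vector N
  | [], ψ => ψ
  | ℓ :: w, ψ => wordAct w (layerAct q ℓ.1 ℓ.2 ψ)

theorem wordAct_append (u w : List Layer) (ψ : Vector N) :
    wordAct q (u ++ w) ψ = wordAct q w (wordAct q u ψ) := by
  induction u generalizing ψ with
  | nil => rfl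
  | cons ℓ u ih => exact ih _

theorem sum_sum_comm {ι α β : Type*} [Fintype α] [Fintype β] (s : Finset ι) (f : α → β → ι → ℝ) :
    ∑ a, ∑ b, ∑ x ∈ s, f a b x = ∑ x ∈ s, ∑ a, ∑ b, f a b x :=
  (Finset.sum_congr rfl fun _ _ => Finset.sum_comm).trans Finset.sum_comm

/-- Linearity of a layer, in the form in which it lets layers on disjoint strands commute. -/
theorem layerAct_sum {ι : Type*} (s : Finset ι) (i : ℕ) (p : Piece) (c : ι → ℝ)
    (ψ : ι → Vector N) (m : List (Bool × Fin N)) :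
    layerAct q i p (fun m => ∑ x ∈ s, c x * ψ x m) m =
      ∑ x ∈ s, c x * layerAct q i p (ψ x) m := by
  induction i generalizing ψ m with
  | zero =>
    rcases p with o | _ | ε
    · rcases m with _ | ⟨x, _ | ⟨y, m⟩⟩ <;> simp only [layerAct, pieceAct, mul_zero,
        Finset.sum_const_zero]
      split_ifs
      · rw [Finset.mul_sum]; exact Finset.sum_congr rfl fun _ _ => by ring
      · simp
    · simp only [layerAct, pieceAct, Finset.mul_sum]
      rw [sum_sum_comm]
      exact Finset.sum_congr rfl fun _ _ => Finset.sum_congr rfl fun _ _ =>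
        Finset.sum_congr rfl fun _ _ => by ring
    · rcases m with _ | ⟨x, _ | ⟨y, m⟩⟩ <;> simp only [layerAct, pieceAct, mul_zero,
        Finset.sum_const_zero]
      simp only [Finset.mul_sum]
      rw [sum_sum_comm]
      exact Finset.sum_congr rfl fun _ _ => Finset.sum_congr rfl fun _ _ =>
        Finset.sum_congr rfl fun _ _ => by ring
  | succ i ih =>
    rcases m with _ | ⟨x, m⟩
    · simp [layerAct]
    · exact ih (fun k m' => ψ k (x :: m')) m

theorem layerAct_sum_sum {α β : Type*} [Fintype α] [Fintype β] (i : ℕ) (p : Piece)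
    (c : α → β → ℝ) (ψ : α → β → Vector N) (m : List (Bool × Fin N)) :
    layerAct q i p (fun m => ∑ a, ∑ b, c a b * ψ a b m) m =
      ∑ a, ∑ b, c a b * layerAct q i p (ψ a b) m := by
  simpa only [Fintype.sum_prod_type] using
    layerAct_sum q Finset.univ i p (fun x : α × β => c x.1 x.2) (fun x => ψ x.1 x.2) m

theorem layerAct_smul (i : ℕ) (p : Piece) (c : ℝ) (ψ : Vector N) (m : List (Bool × Fin N)) :
    layerAct q i p (fun m => c * ψ m) m = c * layerAct q i p ψ m := by
  simpa using layerAct_sum q (Finset.univ : Finset Unit) i p (fun _ => c) (fun _ => ψ) m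

theorem wordAct_add (w : List Layer) (c d : ℝ) (ψ φ : Vector N) :
    wordAct q w (fun m => c * ψ m + d * φ m) =
      fun m => c * wordAct q w ψ m + d * wordAct q w φ m := by
  induction w generalizing ψ φ with
  | nil => rfl
  | cons ℓ w ih =>
    simp only [wordAct]
    rw [← ih]
    congr 1
    funext m
    simpa using layerAct_sum q (Finset.univ : Finset Bool) ℓ.1 ℓ.2 (fun b => cond b c d)
      (fun b => cond b ψ φ) m

theorem wordAct_shift_cons (u : List Layer) (ψ : Vector N) (x : Bool × Fin N)
    (m : List (Bool × Fin N)) :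
    wordAct q (shift u) ψ (x :: m) = wordAct q u (fun m' => ψ (x :: m')) m := by
  induction u generalizing ψ with
  | nil => rfl
  | cons ℓ u ih => exact ih _

theorem wordAct_shift_nil {u : List Layer} (hu : u ≠ []) (ψ : Vector N) :
    wordAct q (shift u) ψ [] = 0 := by
  induction u generalizing ψ with
  | nil => exact absurd rfl hu
  | cons ℓ u ih =>
    cases u with
    | nil => rfl
    | cons ℓ' u => exact ih (by simp) _

/-- `ψ` vanishes except on labellings of the section `s`. -/
def Supp (s : List Bool) (ψ : Vector N) : Prop := ∀ m, m.map Prod.fst ≠ s → ψ m = 0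

theorem Supp.cons {s : List Bool} {ψ : Vector N} {a : Bool} (h : Supp (a :: s) ψ)
    (x : Bool × Fin N) : Supp s fun m => ψ (x :: m) := by
  intro m hm
  exact h _ fun e => hm (List.cons.inj (by simpa using e)).2

/-- Supports have to be followed because moves with an empty side hold only on suitable sections: a
zigzag kills the vectors whose strand has the other orientation, whereas the empty word fixes them.
-/
theorem Supp.layerAct {s t : List Bool} {i : ℕ} {p : Piece} {ψ : Vector N} (h : Supp s ψ)
    (hn : next i p s = some t) : Supp t (layerAct q i p ψ) := by
  induction i generalizing s t ψ with
  | zero =>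
    rcases p with o | _ | ε
    · simp only [next, Option.some.injEq] at hn
      subst hn
      rintro (_ | ⟨x, _ | ⟨y, m⟩⟩) hm <;> simp only [StateModel.layerAct, pieceAct]
      split_ifs with hx
      · rw [h m, mul_zero]
        rintro rfl
        exact hm (by simp [hx.1, hx.2.1])
      · rfl
    · rcases s with _ | ⟨a, _ | ⟨b, s⟩⟩ <;> simp [next] at hn
      obtain ⟨rfl, rfl⟩ := hn
      intro m hm
      simp only [StateModel.layerAct, pieceAct]
      refine Finset.sum_eq_zero fun o _ => Finset.sum_eq_zero fun i _ => ?_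
      rw [h _ (by simp_all), mul_zero]
    · rcases s with _ | ⟨a, _ | ⟨b, s⟩⟩ <;> simp [next] at hn
      subst hn
      rintro (_ | ⟨x, _ | ⟨y, m⟩⟩) hm <;> simp only [StateModel.layerAct, pieceAct]
      refine Finset.sum_eq_zero fun o _ => Finset.sum_eq_zero fun i _ => ?_
      rw [h _ (by simp at hm ⊢; tauto), mul_zero]
  | succ i ih =>
    rcases s with _ | ⟨a, s⟩ <;> simp [next] at hn
    obtain ⟨t, hn, rfl⟩ := hn
    rintro (_ | ⟨x, m⟩) hm
    · rfl
    · by_cases hx : x.1 = a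
      · exact ih (h.cons x) hn m (by simpa [hx] using hm)
      · have h0 : (fun m => ψ (x :: m)) = fun m => 0 * ψ (x :: m) := by
          funext m; rw [h _ (by simp [hx]), mul_zero]
        change StateModel.layerAct q i p (fun m => ψ (x :: m)) m = 0
        rw [h0, layerAct_smul, zero_mul]

theorem Supp.wordAct {s t : List Bool} {w : List Layer} {ψ : Vector N} (h : Supp s ψ)
    (hw : run w s = some t) : Supp t (wordAct q w ψ) := by
  induction w generalizing s ψ with
  | nil => cases hw; exact h
  | cons ℓ w ih =>
    obtain ⟨u, hu, hw⟩ := Option.bind_eq_some_iff.1 hw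
    exact ih (h.layerAct q hu) hw

/-- The words `u`, `u'` act in the same way on the vectors supported on the section `s`. -/
def Equiv (N : ℕ) (q : ℝ) (s : List Bool) (u u' : List Layer) : Prop :=
  ∀ ψ : Vector N, Supp s ψ → wordAct q u ψ = wordAct q u' ψ

variable {q} {s t : List Bool} {u u' u'' : List Layer}

theorem Equiv.symm (h : Equiv N q s u u') : Equiv N q s u' u := fun ψ hψ => (h ψ hψ).symm

theorem Equiv.trans (h : Equiv N q s u u') (h' : Equiv N q s u' u'') : Equiv N q s u u'' :=
  fun ψ hψ => (h ψ hψ).trans (h' ψ hψ)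

theorem Equiv.context (h : Equiv N q t u u') (w₁ w₂ : List Layer) (hw : run w₁ s = some t) :
    Equiv N q s (w₁ ++ u ++ w₂) (w₁ ++ u' ++ w₂) := by
  intro ψ hψ
  simp only [wordAct_append]
  rw [h _ (hψ.wordAct q hw)]

theorem Equiv.shift (h : Equiv N q s u u') (a : Bool) :
    Equiv N q (a :: s) (shift u) (shift u') := by
  intro ψ hψ
  funext m
  rcases m with _ | ⟨x, m⟩
  · have h0 : ∀ u : List Layer, wordAct q (Homflypt.shift u) ψ [] = 0 := by
      intro u
      rcases eq_or_ne u [] with rfl | hu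
      · exact hψ [] (by simp)
      · exact wordAct_shift_nil q hu ψ
    rw [h0, h0]
  · rw [wordAct_shift_cons, wordAct_shift_cons, h _ (hψ.cons x)]

/-- The words `u`, `u'` act in the same way on all vectors. -/
def SameAct (N : ℕ) (q : ℝ) (u u' : List Layer) : Prop :=
  ∀ ψ : Vector N, wordAct q u ψ = wordAct q u' ψ

theorem SameAct.context (h : SameAct N q u u') (w₁ w₂ : List Layer) :
    SameAct N q (w₁ ++ u ++ w₂) (w₁ ++ u' ++ w₂) := by
  intro ψ
  simp only [wordAct_append]
  rw [h]

theorem SameAct.trans (h : SameAct N q u u') (h' : SameAct N q u' u'') : SameAct N q u u'' :=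
  fun ψ => (h ψ).trans (h' ψ)

theorem SameAct.equiv (h : SameAct N q u u') (s : List Bool) : Equiv N q s u u' := fun ψ _ => h ψ

/-- Both words must be nonempty: a shifted layer annihilates the value at the empty labelling, while
the empty word preserves it. -/
theorem SameAct.shift (h : SameAct N q u u') (hu : u ≠ []) (hu' : u' ≠ []) :
    SameAct N q (shift u) (shift u') := by
  intro ψ
  funext m
  rcases m with _ | ⟨x, m⟩
  · rw [wordAct_shift_nil q hu, wordAct_shift_nil q hu']
  · rw [wordAct_shift_cons, wordAct_shift_cons, h]

/-! ### Invariance under planar isotopy and the first two Reidemeister moves -/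

theorem sameAct_slide_cap (hq : q ≠ 0) (i : ℕ) (ε : Bool) :
    SameAct N q [(i, .cross ε), (i + 1, .cap)] [(i + 1, .cross !ε), (i, .cap)] := by
  induction i with
  | zero =>
    intro ψ
    funext m
    rcases m with _ | ⟨x, m⟩
    · simp [wordAct, layerAct, pieceAct]
    · simp only [wordAct, layerAct, pieceAct, Finset.mul_sum]
      refine Finset.sum_congr rfl fun a _ => ?_
      have : ∀ f : Fin N → Fin N → Fin N → ℝ, ∑ i, ∑ j, ∑ k, f i j k = ∑ j, ∑ k, ∑ i, f i j k := by
        intro f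
        rw [Finset.sum_comm]
        exact Finset.sum_congr rfl fun _ _ => Finset.sum_comm
      rw [this]
      refine Finset.sum_congr rfl fun i _ => Finset.sum_congr rfl fun j _ =>
        Finset.sum_congr rfl fun k _ => ?_
      rw [← mul_assoc, ← mul_assoc, capWeight_mul_crossing hq]
  | succ i ih => exact ih.shift (by simp) (by simp)

theorem sameAct_slide_cup (hq : q ≠ 0) (i : ℕ) (o ε : Bool) :
    SameAct N q [(i + 1, .cup o), (i, .cross ε)] [(i, .cup o), (i + 1, .cross !ε)] := by
  induction i with
  | zero =>
    intro ψ
    funext m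
    rcases m with _ | ⟨x, _ | ⟨y, _ | ⟨w, m⟩⟩⟩
    · simp [wordAct, layerAct, pieceAct]
    · simp [wordAct, layerAct, pieceAct]
    · simp [wordAct, layerAct, pieceAct]
    · simp only [wordAct, layerAct, pieceAct]
      by_cases hx : x.1 = o
      · by_cases hw : w.1 = !o
        · simp [hx, hw]
          refine Finset.sum_congr rfl fun i _ => ?_
          rw [← mul_assoc, ← mul_assoc, crossing_mul_cupWeight hq]
        · simp [hw]
      · simp [hx]
  | succ i ih => exact ih.shift (by simp) (by simp)

theorem sameAct_reidemeister₁_cup (hq : q ≠ 0) (i : ℕ) (o ε : Bool) :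
    SameAct N q [(i, .cup o), (i, .cross ε)] [(i, .cup !o)] := by
  induction i with
  | zero =>
    intro ψ
    funext m
    rcases m with _ | ⟨x, _ | ⟨y, m⟩⟩
    · simp [wordAct, layerAct, pieceAct]
    · simp [wordAct, layerAct, pieceAct]
    · simp only [wordAct, layerAct, pieceAct]
      by_cases hy : y.1 = o
      · by_cases hx : x.1 = !o
        · have h := sum_crossing_mul_cupWeight hq ε o x.2 y.2
          simp [hx, hy, ← mul_assoc, ← Finset.sum_mul, h]
        · simp [hx]
      · simp [hy]
  | succ i ih => exact ih.shift (by simp) (by simp)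

theorem sameAct_reidemeister₁_cap (hq : q ≠ 0) (i : ℕ) (ε : Bool) :
    SameAct N q [(i, .cross ε), (i, .cap)] [(i, .cap)] := by
  induction i with
  | zero =>
    intro ψ
    funext m
    simp only [wordAct, layerAct, pieceAct, Finset.mul_sum]
    have key : ∀ a : Bool, ∑ k : Fin N, ∑ i : Fin N, ∑ j : Fin N, capWeight q (!a) k *
        (crossing q ε a (!a) i j k k * ψ ((a, i) :: (!a, j) :: m)) =
        ∑ i : Fin N, capWeight q a i * ψ ((a, i) :: (!a, i) :: m) := by
      intro a
      rw [Finset.sum_comm]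
      refine Finset.sum_congr rfl fun i _ => ?_
      rw [Finset.sum_comm]
      simp_rw [← mul_assoc, ← Finset.sum_mul, sum_capWeight_mul_crossing hq]
      simp
    have h1 := key true
    have h2 := key false
    simp only [Fintype.sum_bool, Bool.not_true, Bool.not_false] at *
    rw [h1, h2, add_comm]
  | succ i ih => exact ih.shift (by simp) (by simp)

theorem sameAct_interchange (i k : ℕ) (g h : Piece) :
    SameAct N q [(i, g), (i + g.out + k, h)] [(i + g.inn + k, h), (i, g)] := by
  induction i with
  | zero =>
    intro ψ
    funext m
    simp only [wordAct, zero_add]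
    rcases g with o | _ | ε
    · rcases m with _ | ⟨x, _ | ⟨y, m⟩⟩
      · simp [layerAct, pieceAct, Piece.out, Nat.add_comm 2]
      · simp [layerAct, pieceAct, Piece.out, Nat.add_comm 2]
      · simp only [layerAct, pieceAct, Piece.out, Piece.inn, Nat.add_comm 2, zero_add]
        split_ifs
        · rw [layerAct_smul]
        · simpa using layerAct_smul q k h 0 ψ m
    · simp only [layerAct, pieceAct, Piece.out, Piece.inn, Nat.add_comm 2, zero_add]
      exact layerAct_sum_sum q k h _ (fun a i m => ψ ((a, i) :: (!a, i) :: m)) m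
    · rcases m with _ | ⟨x, _ | ⟨y, m⟩⟩
      · simp [layerAct, pieceAct, Piece.out, Nat.add_comm 2]
      · simp [layerAct, pieceAct, Piece.out, Nat.add_comm 2]
      · simp only [layerAct, pieceAct, Piece.out, Piece.inn, Nat.add_comm 2]
        exact layerAct_sum_sum q k h _ (fun i j m => ψ ((y.1, i) :: (x.1, j) :: m)) m
  | succ i ih =>
    have := ih.shift (by simp) (by simp)
    simpa [Homflypt.shift, Nat.add_right_comm] using this

theorem equiv_zigzag (hq : q ≠ 0) (o : Bool) (s : List Bool) :
    Equiv N q ((!o) :: s) [(1, .cup o), (0, .cap)] [] := by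
  intro ψ hψ
  funext m
  rcases m with _ | ⟨x, m⟩
  · rw [show wordAct q [] ψ = ψ from rfl, hψ [] (by simp)]
    simp [wordAct, layerAct, pieceAct]
  · have h1 : ∀ a (i : Fin N), capWeight q a i ≠ 0 := capWeight_ne_zero hq
    by_cases hx : x.1 = !o
    · have hx' : x = (!o, x.2) := Prod.ext hx rfl
      rw [hx']
      cases o <;> simp [wordAct, layerAct, pieceAct, ite_and, cupWeight, h1]
    · rw [show wordAct q [] ψ = ψ from rfl, hψ _ (by simp [hx])]
      simp [wordAct, layerAct, pieceAct, hx]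

theorem equiv_zigzag' (hq : q ≠ 0) (o : Bool) (s : List Bool) :
    Equiv N q (o :: s) [(0, .cup o), (1, .cap)] [] := by
  intro ψ hψ
  funext m
  rcases m with _ | ⟨x, m⟩
  · rw [show wordAct q [] ψ = ψ from rfl, hψ [] (by simp)]
    simp [wordAct, layerAct, pieceAct]
  · have h1 : ∀ a (i : Fin N), capWeight q a i ≠ 0 := capWeight_ne_zero hq
    by_cases hx : x.1 = o
    · have hx' : x = (o, x.2) := Prod.ext hx rfl
      rw [hx']
      cases o <;> simp [wordAct, layerAct, pieceAct, ite_and, cupWeight, h1]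
    · rw [show wordAct q [] ψ = ψ from rfl, hψ _ (by simp [hx])]
      simp [wordAct, layerAct, pieceAct, hx]

theorem equiv_reidemeister₂ (hq : q ≠ 0) (ε a b : Bool) (s : List Bool) :
    Equiv N q (a :: b :: s) [(0, .cross ε), (0, .cross !ε)] [] := by
  intro ψ hψ
  funext m
  rcases m with _ | ⟨x, _ | ⟨y, m⟩⟩
  · rw [show wordAct q [] ψ = ψ from rfl, hψ [] (by simp)]
    simp [wordAct, layerAct, pieceAct]
  · rw [show wordAct q [] ψ = ψ from rfl, hψ _ (by simp)]
    simp [wordAct, layerAct, pieceAct]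
  · simp only [wordAct, layerAct, pieceAct, Finset.mul_sum]
    have e : ∀ f : Fin N → Fin N → Fin N → Fin N → ℝ,
        ∑ p, ∑ r, ∑ i, ∑ j, f p r i j = ∑ i, ∑ j, ∑ p, ∑ r, f p r i j := by
      intro f
      rw [sum_sum_comm]
      exact Finset.sum_congr rfl fun _ _ => sum_sum_comm _ _
    rw [e]
    have e2 : ∀ i j, ∑ p : Fin N, ∑ r : Fin N, crossing q (!ε) y.1 x.1 p r x.2 y.2 *
        (crossing q ε x.1 y.1 i j p r * ψ ((x.1, i) :: (y.1, j) :: m)) =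
        (if i = x.2 ∧ j = y.2 then 1 else 0) * ψ ((x.1, i) :: (y.1, j) :: m) := by
      intro i j
      rw [← crossing_inverse hq ε y.1 x.1, Finset.sum_mul]
      refine Finset.sum_congr rfl fun _ _ => ?_
      rw [Finset.sum_mul]
      exact Finset.sum_congr rfl fun _ _ => by ring
    simp_rw [e2]
    simp [ite_and]


variable {N : ℕ} {q : ℝ}

/-! ### The third Reidemeister move -/

/-- The third Reidemeister move on strands with the orientations `a`, `b`, `c`. -/
def YangBaxter (N : ℕ) (q : ℝ) (a b c : Bool) (α β γ : Bool) : Prop :=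
  ∀ s : List Bool, Equiv N q (a :: b :: c :: s)
    [(0, .cross α), (1, .cross β), (0, .cross γ)] [(1, .cross γ), (0, .cross β), (1, .cross α)]

/-- The Yang–Baxter equation for the `R`-matrix. The weights depend only on the relative order of
the three colours, so finitely many rational identities in `q` suffice. -/
theorem yangBaxter_up (hq : q ≠ 0) : YangBaxter N q true true true true true true := by
  intro s ψ hψ
  have hN := pow_ne_zero N hq
  funext m
  rcases m with _ | ⟨x, _ | ⟨y, _ | ⟨w, m⟩⟩⟩
  · simp [wordAct, layerAct, pieceAct]
  · simp [wordAct, layerAct, pieceAct]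
  · simp [wordAct, layerAct, pieceAct]
  · by_cases h : x.1 = true ∧ y.1 = true ∧ w.1 = true
    · obtain ⟨hx, hy, hw⟩ := h
      simp only [wordAct, layerAct, pieceAct, hx, hy, hw, crossing, sum_upCrossing_mul]
      generalize x.2 = i, y.2 = j, w.2 = k
      clear hψ hx hy hw
      have tri : ∀ i j : Fin N, (i < j ∧ i ≠ j ∧ j ≠ i ∧ ¬ j < i) ∨ i = j ∨
          (j < i ∧ j ≠ i ∧ i ≠ j ∧ ¬ i < j) := by
        intro i j
        rcases lt_trichotomy i j with h | h | h
        · exact .inl ⟨h, h.ne, h.ne', h.not_gt⟩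
        · exact .inr (.inl h)
        · exact .inr (.inr ⟨h, h.ne, h.ne', h.not_gt⟩)
      have tij := tri i j
      have tjk := tri j k
      have tik := tri i k
      clear tri
      rcases tij with ⟨h1, h2, h3, h4⟩ | rfl | ⟨h1, h2, h3, h4⟩ <;>
        rcases tjk with ⟨h5, h6, h7, h8⟩ | rfl | ⟨h5, h6, h7, h8⟩ <;>
        rcases tik with ⟨h9, h10, h11, h12⟩ | h9 | ⟨h9, h10, h11, h12⟩ <;>
        first
        | (exfalso; omega)
        | rfl
        | (try subst h9
           simp only [through, turn, if_true, lt_irrefl, if_false, *]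
           try (field_simp <;> ring))
    -- On labellings that are not entirely upward both sides vanish by their support.
    · have hs : run [(0, .cross true), (1, .cross true), (0, .cross true)] (true :: true :: true :: s) =
        some (true :: true :: true :: s) := rfl
      have hs' : run [(1, .cross true), (0, .cross true), (1, .cross true)] (true :: true :: true :: s) =
        some (true :: true :: true :: s) := rfl
      have hm : (x :: y :: w :: m).map Prod.fst ≠ true :: true :: true :: s := by
        intro e; simp at e; exact h ⟨e.1, e.2.1, e.2.2.1⟩
      rw [hψ.wordAct q hs _ hm, hψ.wordAct q hs' _ hm]

variable {a b c α β γ : Bool}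

/-- Multiply `σ₁^α σ₂^β σ₁^γ = σ₂^γ σ₁^β σ₂^α` by `σ₁^(-α)` below and by `σ₂^(-α)` above, then
cancel with the second Reidemeister move. -/
theorem YangBaxter.swap_left (hq : q ≠ 0) (h : YangBaxter N q a b c α β γ) :
    YangBaxter N q b a c (!α) γ β := by
  intro s
  have r2 := equiv_reidemeister₂ (N := N) hq
  have e1 := ((r2 α a b s).shift c).context (s := b :: a :: c :: s)
    [(0, .cross !α), (1, .cross γ), (0, .cross β)] [] rfl
  have e2 := (h s).context (s := b :: a :: c :: s) [(0, .cross !α)] [(1, .cross !α)] rfl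
  have e3 := (r2 (!α) b a (c :: s)).context [] [(1, .cross β), (0, .cross γ), (1, .cross !α)] rfl
  rw [Bool.not_not] at e3
  exact e1.symm.trans (e2.symm.trans e3)

theorem YangBaxter.swap_right (hq : q ≠ 0) (h : YangBaxter N q a b c α β γ) :
    YangBaxter N q a c b β α (!γ) := by
  intro s
  have r2 := equiv_reidemeister₂ (N := N) hq
  have e1 := (r2 γ b c (a :: s)).context (s := a :: c :: b :: s)
    [(1, .cross !γ), (0, .cross α), (1, .cross β)] [] rfl
  have e2 := (h s).context (s := a :: c :: b :: s) [(1, .cross !γ)] [(0, .cross !γ)] rfl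
  have e3 := ((r2 (!γ) c b s).shift a).context [] [(0, .cross β), (1, .cross α), (0, .cross !γ)] rfl
  rw [Bool.not_not] at e3
  exact e3.symm.trans (e2.symm.trans e1)

/-- A zigzag is inserted at the upper end of the strand that starts at the left. Sliding its maximum
down through the crossings turns this strand into a third strand of the opposite orientation on the
right of `a` and `b`, where the known move applies. -/
theorem YangBaxter.rotate (hq : q ≠ 0) (h : YangBaxter N q a b c α β γ) :
    YangBaxter N q (!c) a b (!β) (!γ) α := by
  intro s
  have zigzag : Equiv N q (b :: a :: (!c) :: s) [(3, .cup c), (2, .cap)] [] :=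
    ((equiv_zigzag hq c s).shift a).shift b
  have z₁ := zigzag.context (s := (!c) :: a :: b :: s)
    [(0, .cross !β), (1, .cross !γ), (0, .cross α)] [] rfl
  have z₂ := zigzag.context (s := (!c) :: a :: b :: s)
    [(1, .cross α), (0, .cross !γ), (1, .cross !β)] [] rfl
  have mid := ((h ((!c) :: s)).shift (!c)).context (s := (!c) :: a :: b :: s)
    [(3, .cup c)] [(0, .cap)] (by simp [run, next])
  have cup₀ : ∀ ε, SameAct N q [(0, .cross ε), (3, .cup c)] [(3, .cup c), (0, .cross ε)] :=
    fun ε => sameAct_interchange 0 1 (.cross ε) (.cup c)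
  have cup₁ : ∀ ε, SameAct N q [(1, .cross ε), (3, .cup c)] [(3, .cup c), (1, .cross ε)] :=
    fun ε => sameAct_interchange 1 0 (.cross ε) (.cup c)
  have cap₂ : ∀ ε, SameAct N q [(0, .cross ε), (2, .cap)] [(2, .cap), (0, .cross ε)] :=
    fun ε => sameAct_interchange 0 0 (.cross ε) .cap
  have cap₀ : ∀ ε, SameAct N q [(0, .cap), (0, .cross ε)] [(2, .cross ε), (0, .cap)] :=
    fun ε => sameAct_interchange 0 0 .cap (.cross ε)
  have far : ∀ ε δ, SameAct N q [(0, .cross ε), (2, .cross δ)] [(2, .cross δ), (0, .cross ε)] :=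
    fun ε δ => sameAct_interchange 0 0 (.cross ε) (.cross δ)
  have slide₁ : SameAct N q [(1, .cross !γ), (2, .cap)] [(2, .cross γ), (1, .cap)] := by
    simpa using sameAct_slide_cap (N := N) hq 1 (!γ)
  have slide₂ : SameAct N q [(0, .cross !β), (1, .cap)] [(1, .cross β), (0, .cap)] := by
    simpa using sameAct_slide_cap (N := N) hq 0 (!β)
  have slide₃ : SameAct N q [(1, .cross !β), (2, .cap)] [(2, .cross β), (1, .cap)] := by
    simpa using sameAct_slide_cap (N := N) hq 1 (!β)
  have slide₄ : SameAct N q [(0, .cross !γ), (1, .cap)] [(1, .cross γ), (0, .cap)] := by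
    simpa using sameAct_slide_cap (N := N) hq 0 (!γ)
  have l : SameAct N q
      [(0, .cross !β), (1, .cross !γ), (0, .cross α), (3, .cup c), (2, .cap)]
      [(3, .cup c), (2, .cross γ), (1, .cross β), (2, .cross α), (0, .cap)] :=
    ((cup₀ α).context [(0, .cross !β), (1, .cross !γ)] [(2, .cap)]).trans <|
    ((cup₁ (!γ)).context [(0, .cross !β)] [(0, .cross α), (2, .cap)]).trans <|
    ((cup₀ (!β)).context [] [(1, .cross !γ), (0, .cross α), (2, .cap)]).trans <|
    ((cap₂ α).context [(3, .cup c), (0, .cross !β), (1, .cross !γ)] []).trans <|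
    (slide₁.context [(3, .cup c), (0, .cross !β)] [(0, .cross α)]).trans <|
    ((far (!β) γ).context [(3, .cup c)] [(1, .cap), (0, .cross α)]).trans <|
    (slide₂.context [(3, .cup c), (2, .cross γ)] [(0, .cross α)]).trans <|
    (cap₀ α).context [(3, .cup c), (2, .cross γ), (1, .cross β)] []
  have r : SameAct N q
      [(1, .cross α), (0, .cross !γ), (1, .cross !β), (3, .cup c), (2, .cap)]
      [(3, .cup c), (1, .cross α), (2, .cross β), (1, .cross γ), (0, .cap)] :=
    ((cup₁ (!β)).context [(1, .cross α), (0, .cross !γ)] [(2, .cap)]).trans <|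
    ((cup₀ (!γ)).context [(1, .cross α)] [(1, .cross !β), (2, .cap)]).trans <|
    ((cup₁ α).context [] [(0, .cross !γ), (1, .cross !β), (2, .cap)]).trans <|
    (slide₃.context [(3, .cup c), (1, .cross α), (0, .cross !γ)] []).trans <|
    ((far (!γ) β).context [(3, .cup c), (1, .cross α)] [(1, .cap)]).trans <|
    slide₄.context [(3, .cup c), (1, .cross α), (2, .cross β)] []
  exact z₁.symm.trans <| (l.equiv _).trans <| mid.symm.trans <| (r.equiv _).symm.trans z₂

theorem yangBaxter (hq : q ≠ 0) (h : α = γ → β = α) : YangBaxter N q a b c α β γ := by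
  -- The two swaps preserve the all-upward orientation and reach from three positive signs each of
  -- the six non-cyclic sign patterns.
  have up : ∀ α β γ, (α = γ → β = α) → YangBaxter N q true true true α β γ := by
    have h0 := yangBaxter_up (N := N) hq
    have h1 := h0.swap_left hq
    have h2 := h0.swap_right hq
    have h3 := h1.swap_right hq
    have h4 := h2.swap_left hq
    have h5 := h3.swap_left hq
    intro α β γ h
    cases α <;> cases β <;> cases γ <;> first | assumption | simp at h
  -- All three operations permute the non-cyclic sign patterns; swaps and rotations together reach
  -- the eight orientations.
  have all : ∀ {a b c : Bool}, (∀ α β γ, (α = γ → β = α) → YangBaxter N q a b c α β γ) →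
      (∀ α β γ, (α = γ → β = α) → YangBaxter N q b a c α β γ) ∧
      (∀ α β γ, (α = γ → β = α) → YangBaxter N q a c b α β γ) ∧
      (∀ α β γ, (α = γ → β = α) → YangBaxter N q (!c) a b α β γ) := by
    intro a b c H
    refine ⟨fun α β γ h => ?_, fun α β γ h => ?_, fun α β γ h => ?_⟩
    · simpa using (H (!α) γ β (by revert h; revert α β γ; decide)).swap_left hq
    · simpa using (H β α (!γ) (by revert h; revert α β γ; decide)).swap_right hq
    · simpa using (H γ (!α) (!β) (by revert h; revert α β γ; decide)).rotate hq
  have h1 := (all up).2.2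
  have h2 := (all h1).1
  have h3 := (all h2).2.1
  have h4 := (all h1).2.2
  have h5 := (all h4).2.1
  have h6 := (all h5).1
  have h7 := (all h4).2.2
  revert h
  cases a <;> cases b <;> cases c <;> intro h <;>
    first | exact up _ _ _ h | exact h1 _ _ _ h | exact h2 _ _ _ h | exact h3 _ _ _ h |
      exact h4 _ _ _ h | exact h5 _ _ _ h | exact h6 _ _ _ h | exact h7 _ _ _ h


variable {N : ℕ} {q : ℝ}

/-! ### The state sum of a diagram -/

theorem equiv_induction {u u' : List Layer} (hu : u ≠ [])
    (h : ∀ s, (run u s).isSome → (run u' s).isSome → Equiv N q s u u') {s : List Bool}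
    (hs : (run (shift u) s).isSome) (hs' : (run (shift u') s).isSome) :
    Equiv N q s (shift u) (shift u') := by
  rcases s with _ | ⟨a, s⟩
  · rw [run_shift_nil hu] at hs; simp at hs
  · rw [run_shift_cons] at hs hs'
    exact (h s (by simpa using hs) (by simpa using hs')).shift a

/-- That both sides run from `s` supplies the strands, and for zigzags the orientation, under which
the local identities hold. -/
theorem equiv_of_move (hq : q ≠ 0) {u u' : List Layer} (h : Move u u') {s : List Bool}
    (hs : (run u s).isSome) (hs' : (run u' s).isSome) : Equiv N q s u u' := by
  cases h with
  | interchange i k g h => exact (sameAct_interchange i k g h).equiv s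
  | zigzag i o =>
    induction i generalizing s with
    | zero =>
      rcases s with _ | ⟨a, s⟩
      · simp [run, next] at hs
      · have : a = !o := by
          cases a <;> cases o <;> simp_all [run, next]
        subst this
        exact equiv_zigzag hq o s
    | succ i ih => exact equiv_induction (by simp) (fun s => ih) hs hs'
  | zigzag' i o =>
    induction i generalizing s with
    | zero =>
      rcases s with _ | ⟨a, s⟩
      · simp [run, next] at hs
      · have : a = o := by
          cases a <;> cases o <;> simp_all [run, next]
        subst this
        exact equiv_zigzag' hq a s
    | succ i ih => exact equiv_induction (by simp) (fun s => ih) hs hs'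
  | slide_cap i ε => exact (sameAct_slide_cap hq i ε).equiv s
  | slide_cup i o ε => exact (sameAct_slide_cup hq i o ε).equiv s
  | reidemeister₁_cup i o ε => exact (sameAct_reidemeister₁_cup hq i o ε).equiv s
  | reidemeister₁_cap i ε => exact (sameAct_reidemeister₁_cap hq i ε).equiv s
  | reidemeister₂ i ε =>
    induction i generalizing s with
    | zero =>
      rcases s with _ | ⟨a, _ | ⟨b, s⟩⟩
      · simp [run, next] at hs
      · simp [run, next] at hs
      · exact equiv_reidemeister₂ hq ε a b s
    | succ i ih => exact equiv_induction (by simp) (fun s => ih) hs hs'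
  | reidemeister₃ i a b c h =>
    induction i generalizing s with
    | zero =>
      rcases s with _ | ⟨x, _ | ⟨y, _ | ⟨w, s⟩⟩⟩
      · simp [run, next] at hs
      · simp [run, next] at hs
      · simp [run, next] at hs
      · exact yangBaxter hq h s
    | succ i ih => exact equiv_induction (by simp) (fun s => ih) hs hs'

/-- The vector concentrated on the empty section. -/
def vacuum (N : ℕ) : Vector N := fun m => if m = [] then 1 else 0

theorem supp_vacuum : Supp (N := N) [] (vacuum N) := by
  intro m hm
  exact if_neg fun h => hm (by simp [h])

/-- The state sum. -/
def stateSum (N : ℕ) (q : ℝ) (D : LinkDiagram) : ℝ := wordAct q D.word (vacuum N) []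

theorem stateSum_eq_of_moveRel (hq : q ≠ 0) {D D' : LinkDiagram} (h : D.MoveRel D') :
    stateSum N q D = stateSum N q D' := by
  obtain ⟨w₁, u, u', w₂, hm, e, e'⟩ := h
  have r := runs_iff_run.1 D.runs
  have r' := runs_iff_run.1 D'.runs
  rw [e, List.append_assoc, run_append] at r
  rw [e', List.append_assoc, run_append] at r'
  obtain ⟨s, hs, r⟩ := Option.bind_eq_some_iff.1 r
  rw [hs, Option.bind_some] at r'
  rw [run_append] at r r'
  obtain ⟨t, ht, -⟩ := Option.bind_eq_some_iff.1 r
  obtain ⟨t', ht', -⟩ := Option.bind_eq_some_iff.1 r'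
  have := (equiv_of_move (N := N) hq hm (s := s) (by simp [ht]) (by simp [ht'])).context w₁ w₂ hs
  rw [stateSum, stateSum, e, e', this _ supp_vacuum]

theorem layerAct_skein (hq : q ≠ 0) (l r : List Bool) (a b : Bool) {ψ : Vector N}
    (hψ : Supp (l ++ [a, b] ++ r) ψ) :
    layerAct q l.length (.cross (a == b)) ψ = fun m =>
      (q ^ N)⁻¹ * (q - q⁻¹) *
        wordAct q (if a = b then [] else [(l.length, .cap), (l.length, .cup b)]) ψ m +
      ((q ^ N)⁻¹) ^ 2 * layerAct q l.length (.cross (a != b)) ψ m := by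
  induction l generalizing ψ with
  | nil =>
    funext m
    have hψ : Supp (a :: b :: r) ψ := hψ
    simp only [List.length_nil]
    by_cases hm : m.map Prod.fst = b :: a :: r
    · rcases m with _ | ⟨⟨b', k⟩, _ | ⟨⟨a', l⟩, m⟩⟩ <;> simp at hm
      obtain ⟨rfl, rfl, rfl⟩ := hm
      simp only [layerAct, pieceAct]
      simp only [crossing_skein hq a' b', add_mul, Finset.sum_add_distrib, mul_assoc,
        ← Finset.mul_sum]
      congr 3
      by_cases hab : a' = b'
      · subst hab
        simp [wordAct, ite_and]
      · obtain rfl : a' = !b' := by cases a' <;> cases b' <;> simp_all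
        simp only [hab, if_false, wordAct, layerAct, pieceAct, true_and]
        by_cases hkl : k = l
        · subst hkl
          -- A cap sums over both orientations of its arc; only the one present in the section
          -- contributes.
          have h0 : ∀ i : Fin N, ψ ((b', i) :: (!b', i) :: m) = 0 := fun i =>
            hψ _ (by simp)
          cases b' <;> simp_all [Finset.mul_sum]
          all_goals exact Finset.sum_congr rfl fun _ _ => by ring
        · simp [hkl]
    · rw [(hψ.layerAct q (p := .cross (a == b)) (i := 0) rfl) m hm,
        (hψ.layerAct q (p := .cross (a != b)) (i := 0) rfl) m hm]
      split_ifs with hab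
      · subst hab; simp [wordAct, hψ m hm]
      · obtain rfl : a = !b := by cases a <;> cases b <;> simp_all
        rw [hψ.wordAct q (w := [(0, .cap), (0, .cup b)]) (t := b :: (!b) :: r)
          (by simp [run, next]) m hm]
        simp
  | cons o l ih =>
    have hψ : Supp (o :: (l ++ [a, b] ++ r)) ψ := hψ
    funext m
    rcases m with _ | ⟨x, m⟩
    · split_ifs <;> simp [layerAct, wordAct, hψ [] (by simp)]
    · have := congrFun (ih (hψ.cons x)) m
      simp only [List.length_cons, layerAct, this]
      split_ifs <;> rfl

theorem stateSum_skein (hq : q ≠ 0) {D₁ D₀ D₂ : LinkDiagram} (h : IsSkeinTriple D₁ D₀ D₂) :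
    stateSum N q D₁ = (q ^ N)⁻¹ * (q - q⁻¹) * stateSum N q D₀ +
      ((q ^ N)⁻¹) ^ 2 * stateSum N q D₂ := by
  obtain ⟨w₁, w₂, l, r, a, b, hw, e₁, e₂, e₀⟩ := h
  have hs := supp_vacuum.wordAct (N := N) q (runs_iff_run.1 hw)
  simp only [stateSum, e₁, e₀, e₂, wordAct_append]
  rw [← congrFun (wordAct_add q w₂ _ _ _ _) []]
  congr 1
  exact layerAct_skein hq l r a b hs

theorem stateSum_unknot : stateSum N q unknot = ∑ i : Fin N, capWeight q true i := by
  have h : ∀ i : Fin N, capWeight q false i = 1 := fun _ => rfl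
  simp [stateSum, unknot, wordAct, layerAct, pieceAct, vacuum, cupWeight, h]

theorem stateSum_unknot_pos (hq : 0 < q) (hN : 0 < N) : 0 < stateSum N q unknot := by
  rw [stateSum_unknot]
  have : Nonempty (Fin N) := ⟨⟨0, hN⟩⟩
  exact Finset.sum_pos (fun i _ => by simp only [capWeight]; positivity) Finset.univ_nonempty

/-- The specialisation `v = q ^ (-N)`, `z = q - q⁻¹`. -/
def specialize (x y : ℝˣ) : LaurentVZ →+* ℝ :=
  LaurentPolynomial.eval₂ (LaurentPolynomial.eval₂ (Int.castRingHom ℝ) x) y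

theorem specialize_v (x y : ℝˣ) : specialize x y v = y := by simp [specialize, v]

theorem specialize_z (x y : ℝˣ) : specialize x y z = x := by simp [specialize, z]

/-- The state sum respects the moves and the skein relation, so its extension, semilinear along
`specialize`, vanishes on `skeinRelations` and descends to the skein module. -/
theorem specialize_eq_of_skeinClass_eq {N : ℕ} {q : ℝ} (hq : q ≠ 0) {x y : ℝˣ}
    (hx : (x : ℝ) = q - q⁻¹) (hy : (y : ℝ) = (q ^ N)⁻¹) {D : LinkDiagram} {f : LaurentVZ}
    (h : D.skeinClass = f • unknot.skeinClass) :
    stateSum N q D = specialize x y f * stateSum N q unknot := by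
  let Φ : (LinkDiagram →₀ LaurentVZ) →ₛₗ[specialize x y] ℝ :=
    { toFun := fun c => c.sum fun D a => specialize x y a * stateSum N q D
      map_add' := fun c d => Finsupp.sum_add_index' (by simp) (by intros; simp [add_mul])
      map_smul' := fun a c => by
        rw [Finsupp.sum_smul_index', smul_eq_mul, Finsupp.mul_sum]
        · simp [mul_assoc]
        · simp }
  have hΦ : ∀ D a, Φ (Finsupp.single D a) = specialize x y a * stateSum N q D := by
    intro D a
    change Finsupp.sum (Finsupp.single D a) (fun D a => specialize x y a * stateSum N q D) = _
    rw [Finsupp.sum_single_index]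
    rw [map_zero, zero_mul]
  have hker : skeinRelations ≤ LinearMap.ker Φ := by
    refine Submodule.span_le.2 ?_
    rintro _ (⟨D, D', hm, rfl⟩ | ⟨D₁, D₀, D₂, hs, rfl⟩)
    · simp [hΦ, stateSum_eq_of_moveRel hq hm]
    · rw [SetLike.mem_coe, LinearMap.mem_ker, map_sub, map_add, map_smulₛₗ, map_smulₛₗ, hΦ, hΦ, hΦ,
        stateSum_skein hq hs]
      simp [specialize_v, specialize_z, hx, hy]
  have : Finsupp.single D 1 - f • Finsupp.single unknot 1 ∈ skeinRelations := by
    rw [← Submodule.Quotient.eq]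
    exact h
  have := hker this
  simpa [hΦ, sub_eq_zero] using this

end StateModel

/-! ### Uniqueness of the Homflypt polynomial -/

/-- After clearing denominators, a polynomial with infinitely many roots is zero. The points may
depend on `i`, since `v = q^(-N)` varies with `q`. -/
theorem eq_zero_of_eval₂_eq_zero {R : Type*} [CommRing R] {ι : Type*} (I : ι → R →+* ℝ)
    (hI : ∀ r, (∀ i, I i r = 0) → r = 0) {f : R[T;T⁻¹]} (y : ι → ℕ → ℝˣ)
    (hy : ∀ i, Function.Injective (y i))
    (h : ∀ i n, LaurentPolynomial.eval₂ (I i) (y i n) f = 0) : f = 0 := by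
  obtain ⟨n, p, hp⟩ := f.exists_T_pow
  have hp0 : p = 0 := by
    ext k
    refine hI _ fun i => ?_
    have : p.map (I i) = 0 := by
      refine Polynomial.eq_zero_of_infinite_isRoot _ (Set.Infinite.mono ?_
        (Set.infinite_range_of_injective (Units.val_injective.comp (hy i))))
      rintro _ ⟨m, rfl⟩
      have := congrArg (LaurentPolynomial.eval₂ (I i) (y i m)) hp
      rw [LaurentPolynomial.eval₂_toLaurent, map_mul, h, zero_mul] at this
      simpa [Polynomial.IsRoot, Polynomial.eval_map] using this
    rw [← Polynomial.coeff_map, this, Polynomial.coeff_zero]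
  rw [hp0, map_zero] at hp
  have := congrArg (· * LaurentPolynomial.T (-n)) hp
  simp only [zero_mul, mul_assoc, ← LaurentPolynomial.T_add, add_neg_cancel,
    LaurentPolynomial.T_zero, mul_one] at this
  exact this.symm

/-- The trivial knot generates a free submodule of the skein module. -/
theorem eq_zero_of_smul_unknot {f : LaurentVZ} (h : f • unknot.skeinClass = 0) : f = 0 := by
  have hq : ∀ n : ℕ, (1 : ℝ) < n + 2 := fun n => by
    have : (0 : ℝ) ≤ n := n.cast_nonneg
    linarith
  have hz : ∀ n : ℕ, ((n : ℝ) + 2) - ((n : ℝ) + 2)⁻¹ ≠ 0 := fun n => by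
    have := inv_lt_one_of_one_lt₀ (hq n)
    have := hq n
    linarith
  -- Here `q = n + 2`, which makes `q - q⁻¹` nonzero and injective in `n`, and `v = q^(-(N+1))`, so
  -- that the number of colours is positive.
  let x : ℕ → ℝˣ := fun n => Units.mk0 _ (hz n)
  let y : ℕ → ℕ → ℝˣ := fun n N => Units.mk0 (((n : ℝ) + 2) ^ (N + 1))⁻¹
    (inv_ne_zero (pow_ne_zero _ (by linarith [hq n])))
  refine eq_zero_of_eval₂_eq_zero
    (fun n => LaurentPolynomial.eval₂ (Int.castRingHom ℝ) (x n)) ?_ y ?_ ?_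
  · intro r hr
    refine eq_zero_of_eval₂_eq_zero (fun _ : Unit => Int.castRingHom ℝ) (by simp)
      (fun _ => x) (fun _ => ?_) (fun _ => hr)
    have : StrictMono fun n : ℕ => ((n : ℝ) + 2) - ((n : ℝ) + 2)⁻¹ := by
      intro m n hmn
      have h1 : (m : ℝ) + 2 < n + 2 := by simpa using hmn
      have := inv_strictAnti₀ (by linarith [hq m]) h1
      dsimp only
      linarith
    exact fun m n e => this.injective (congrArg Units.val e)
  · intro n N M e
    have e := congrArg Units.val e
    simp only [y, Units.val_mk0, inv_inj] at e
    have := pow_right_injective₀ (by linarith [hq n]) (hq n).ne' e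
    omega
  · intro n N
    have h0 : (0 : ℝ) < n + 2 := by linarith [hq n]
    -- Adding `f` to the trivial coefficient `1` gives a second expression of the unknot, whose
    -- state sum is nonzero.
    have h' : (unknot).skeinClass = (1 + f) • unknot.skeinClass := by rw [add_smul, h]; simp
    have := StateModel.specialize_eq_of_skeinClass_eq (N := N + 1) h0.ne' (x := x n) (y := y n N)
      rfl rfl h'
    rw [map_add, map_one, add_mul, one_mul, left_eq_add, mul_eq_zero] at this
    exact this.resolve_right (StateModel.stateSum_unknot_pos h0 N.succ_pos).ne'

/-- By freeness the `Classical.epsilon` choice is unique, so any coefficient obtained by skein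
computations is the polynomial. -/
theorem homflypt_eq {D : LinkDiagram} {f : LaurentVZ}
    (h : D.skeinClass = f • unknot.skeinClass) : homflypt D = f := by
  have := h.symm.trans <| Classical.epsilon_spec (p := fun f : LaurentVZ => D.skeinClass = f • unknot.skeinClass)
    ⟨f, h⟩
  rw [← sub_eq_zero, ← sub_smul] at this
  exact (sub_eq_zero.1 (eq_zero_of_smul_unknot this)).symm


/-! ### Functions on braid words that satisfy the normalised skein relation -/

/-- `F` is invariant under free reduction and satisfies the quadratic relation
`σ_i = z + σ_i⁻¹`. -/
structure IsSkeinFunction {R M : Type} [CommRing R] [AddCommGroup M] [Module R M] {n : ℕ} (t : R)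
    (F : BraidWord n → M) : Prop where
  cancel : ∀ u w i ε, F (u ++ [(i, ε), (i, !ε)] ++ w) = F (u ++ w)
  skein : ∀ u w i, F (u ++ [(i, true)] ++ w) = t • F (u ++ w) + F (u ++ [(i, false)] ++ w)

/-- `F` moreover satisfies the braid relation and has the values of a conjugation invariant
function. -/
structure IsSkeinTrace {R M : Type} [CommRing R] [AddCommGroup M] [Module R M] (t : R)
    (F : BraidWord 3 → M) : Prop extends IsSkeinFunction t F where
  braid : ∀ u w, F (u ++ [(0, true), (1, true), (0, true)] ++ w) =
    F (u ++ [(1, true), (0, true), (1, true)] ++ w)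
  conj₁ : F [(1, true)] = F [(0, true)]
  conj₂ : F [(1, true), (0, true)] = F [(0, true), (1, true)]
  conj₃ : F [(0, true), (1, true), (0, true)] = F [(0, true), (0, true), (1, true)]

variable {R M : Type} [CommRing R] [AddCommGroup M] [Module R M] {n : ℕ} {t : R}

theorem IsSkeinFunction.square {F : BraidWord n → M} (hF : IsSkeinFunction t F)
    (u w : BraidWord n) (i : Fin (n - 1)) :
    F (u ++ [(i, true), (i, true)] ++ w) = t • F (u ++ [(i, true)] ++ w) + F (u ++ w) := by
  have h1 := hF.skein u ([(i, true)] ++ w) i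
  have h2 := hF.cancel u w i false
  simp only [List.append_assoc, List.cons_append, List.nil_append, Bool.not_false] at *
  rw [h1, h2]

/-- For `p ≥ 0` this is the skein or the square relation at the end of the word; for `p < 0` the
words consist of inverses, and a cancelling pair has to be inserted first. -/
theorem IsSkeinFunction.twist_add_one {F : BraidWord 2 → M} (hF : IsSkeinFunction t F) (p : ℤ) :
    F (twist (p + 1)) = t • F (twist p) + F (twist (p - 1)) := by
  rcases lt_trichotomy p 0 with h | rfl | h
  · obtain ⟨k, rfl⟩ : ∃ k : ℕ, p = -(k + 1) := ⟨(-p - 1).toNat, by omega⟩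
    have e1 : twist (-(k + 1 : ℤ) + 1) = List.replicate k (0, false) := by
      rcases k with _ | k
      · rfl
      · simp only [twist]
        rw [show (-((k + 1 : ℕ) + 1 : ℤ) + 1).natAbs = k + 1 by omega, decide_eq_false (by omega)]
    have e2 : twist (-(k + 1 : ℤ)) = List.replicate k (0, false) ++ [(0, false)] := by
      simp only [twist]
      rw [show (-(k + 1 : ℤ)).natAbs = k + 1 by omega, decide_eq_false (by omega),
        List.replicate_succ']
    have e3 : twist (-(k + 1 : ℤ) - 1) =
        List.replicate k (0, false) ++ [(0, false)] ++ [(0, false)] := by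
      simp only [twist]
      rw [show (-(k + 1 : ℤ) - 1).natAbs = k + 2 by omega, decide_eq_false (by omega),
        List.replicate_succ', List.replicate_succ']
    have h1 := hF.skein (List.replicate k (0, false) ++ [(0, false)]) [] 0
    have h2 := hF.cancel (List.replicate k (0, false)) [] 0 false
    simp only [List.append_assoc, List.cons_append, List.nil_append, Bool.not_false,
      List.append_nil] at *
    rw [e1, e2, e3, ← h2, h1]
  · exact hF.skein [] [] 0
  · obtain ⟨k, rfl⟩ : ∃ k : ℕ, p = k + 1 := ⟨(p - 1).toNat, by omega⟩
    have e1 : twist (k + 1 - 1 : ℤ) = List.replicate k (0, true) := by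
      simp only [twist]
      rw [show (k + 1 - 1 : ℤ).natAbs = k by omega, decide_eq_true (by omega)]
    have e2 : twist (k + 1 : ℤ) = List.replicate k (0, true) ++ [(0, true)] := by
      simp only [twist]
      rw [show (k + 1 : ℤ).natAbs = k + 1 by omega, decide_eq_true (by omega),
        List.replicate_succ']
    have e3 : twist (k + 1 + 1 : ℤ) =
        List.replicate k (0, true) ++ [(0, true)] ++ [(0, true)] := by
      simp only [twist]
      rw [show (k + 1 + 1 : ℤ).natAbs = k + 2 by omega, decide_eq_true (by omega),
        List.replicate_succ', List.replicate_succ']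
    have h1 := hF.square (List.replicate k (0, true)) [] 0
    simp only [List.append_assoc, List.cons_append, List.nil_append, List.append_nil] at *
    rw [e1, e2, e3, h1]

/-- The substitution `X = t` in a polynomial with integral coefficients. -/
def evalInt {R : Type} [CommRing R] (t : R) : ℤ[X] →+* R :=
  Polynomial.eval₂RingHom (Int.castRingHom R) t

theorem evalInt_X {R : Type} [CommRing R] (t : R) : evalInt t .X = t := by simp [evalInt]

/-- The words `1, σ₁, σ₂, σ₁σ₂, σ₂σ₁, σ₁σ₂σ₁` span, with coefficients in `ℤ[z]`. -/
theorem exists_coeff (β : BraidWord 3) : ∃ c₀ c₁ c₂ c₃ c₄ c₅ : ℤ[X],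
    ∀ (R M : Type) [CommRing R] [AddCommGroup M] [Module R M] (t : R) (F : BraidWord 3 → M),
      IsSkeinFunction t F →
      (∀ u w, F (u ++ [(0, true), (1, true), (0, true)] ++ w) =
        F (u ++ [(1, true), (0, true), (1, true)] ++ w)) →
      F β = evalInt t c₀ • F [] + evalInt t c₁ • F [(0, true)] +
        evalInt t c₂ • F [(1, true)] + evalInt t c₃ • F [(0, true), (1, true)] +
        evalInt t c₄ • F [(1, true), (0, true)] +
        evalInt t c₅ • F [(0, true), (1, true), (0, true)] := by
  induction β with
  | nil => exact ⟨1, 0, 0, 0, 0, 0, by intros; simp⟩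
  | cons g β ih =>
    obtain ⟨c₀, c₁, c₂, c₃, c₄, c₅, ih⟩ := ih
    -- The function `w ↦ F (g :: w)` satisfies the same relations, so the induction hypothesis
    -- applies to it. It need not be a trace, hence the conjugation conditions stay out of the
    -- induction.
    have key : ∀ (R M : Type) [CommRing R] [AddCommGroup M] [Module R M] (t : R)
        (F : BraidWord 3 → M), IsSkeinFunction t F →
        (∀ u w, F (u ++ [(0, true), (1, true), (0, true)] ++ w) =
          F (u ++ [(1, true), (0, true), (1, true)] ++ w)) →
        F (g :: β) = evalInt t c₀ • F [g] + evalInt t c₁ • F [g, (0, true)] +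
        evalInt t c₂ • F [g, (1, true)] +
        evalInt t c₃ • F [g, (0, true), (1, true)] +
        evalInt t c₄ • F [g, (1, true), (0, true)] +
        evalInt t c₅ • F [g, (0, true), (1, true), (0, true)] := by
      intro R M _ _ _ t F hF hb
      exact ih R M t (fun w => F (g :: w))
        ⟨fun u w i ε => hF.cancel (g :: u) w i ε, fun u w i => hF.skein (g :: u) w i⟩
        (fun u w => hb (g :: u) w)
    have inv : ∀ {R M : Type} [CommRing R] [AddCommGroup M] [Module R M] {t : R}
        {F : BraidWord 3 → M}, IsSkeinFunction t F → ∀ (i : Fin 2) (w : BraidWord 3),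
        F ((i, false) :: w) = F ((i, true) :: w) - t • F w := by
      intro R M _ _ _ t F hF i w
      have := hF.skein [] w i
      simp only [List.nil_append, List.cons_append] at this
      rw [this, add_sub_cancel_left]
    have sq : ∀ {R M : Type} [CommRing R] [AddCommGroup M] [Module R M] {t : R}
        {F : BraidWord 3 → M}, IsSkeinFunction t F → ∀ (i : Fin 2) (w : BraidWord 3),
        F ((i, true) :: (i, true) :: w) = t • F ((i, true) :: w) + F w := fun hF i w =>
      hF.square [] w i
    have br : ∀ {R M : Type} [CommRing R] [AddCommGroup M] [Module R M] {t : R}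
        {F : BraidWord 3 → M}, IsSkeinFunction t F →
        (∀ u w, F (u ++ [(0, true), (1, true), (0, true)] ++ w) =
          F (u ++ [(1, true), (0, true), (1, true)] ++ w)) →
        F [(1, true), (0, true), (1, true), (0, true)] =
          t • F [(0, true), (1, true), (0, true)] + F [(0, true), (1, true)] := by
      intro R M _ _ _ t F hF hb
      have h1 := hb [] [(0, true)]
      have h2 := hF.square [(0, true), (1, true)] [] 0
      exact h1.symm.trans h2
    obtain ⟨i, ε⟩ := g
    -- The witnesses are the table of left multiplication by a generator or its inverse on the six
    -- words.
    fin_cases i <;> cases ε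
    · refine ⟨c₁ - .X * c₀, c₀, c₃ - .X * c₂, c₂, c₅ - .X * c₄, c₄, ?_⟩
      intro R M _ _ _ t F hF hb
      rw [key R M t F hF hb]
      simp only [Fin.zero_eta, inv hF, sq hF, map_sub, map_mul, evalInt_X]
      module
    · refine ⟨c₁, c₀ + .X * c₁, c₃, c₂ + .X * c₃, c₅, c₄ + .X * c₅, ?_⟩
      intro R M _ _ _ t F hF hb
      rw [key R M t F hF hb]
      simp only [Fin.zero_eta, sq hF, map_add, map_mul, evalInt_X]
      module
    · refine ⟨c₂ - .X * c₀, c₄ - .X * c₁, c₀, c₅ - .X * c₃, c₁, c₃, ?_⟩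
      intro R M _ _ _ t F hF hb
      rw [key R M t F hF hb]
      have h3 := hb [] []
      simp only [List.nil_append, List.append_nil] at h3
      simp only [Fin.mk_one, inv hF, sq hF, br hF hb, ← h3, map_sub, map_mul, evalInt_X]
      module
    · refine ⟨c₂, c₄, c₀ + .X * c₂, c₅, c₁ + .X * c₄, c₃ + .X * c₅, ?_⟩
      intro R M _ _ _ t F hF hb
      rw [key R M t F hF hb]
      have h3 := hb [] []
      simp only [List.nil_append, List.append_nil] at h3
      simp only [Fin.mk_one, sq hF, br hF hb, ← h3, map_add, map_mul, evalInt_X]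
      module

/-- A skein trace is determined by its values at `1`, `σ₁` and `σ₁σ₂`. -/
theorem exists_trace_coeff (β : BraidWord 3) : ∃ a b c : ℤ[X],
    ∀ (R M : Type) [CommRing R] [AddCommGroup M] [Module R M] (t : R) (F : BraidWord 3 → M),
      IsSkeinTrace t F → F β = evalInt t a • F [] +
        evalInt t b • F [(0, true)] + evalInt t c • F [(0, true), (1, true)] := by
  obtain ⟨c₀, c₁, c₂, c₃, c₄, c₅, h⟩ := exists_coeff β
  refine ⟨c₀, c₁ + c₂ + c₅, c₃ + c₄ + .X * c₅, ?_⟩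
  intro R M _ _ _ t F hF
  -- `σ₁σ₂σ₁` is conjugate to `σ₁²σ₂ = zσ₁σ₂ + σ₂`.
  have h5 : F [(0, true), (1, true), (0, true)] = t • F [(0, true), (1, true)] + F [(0, true)] := by
    rw [hF.conj₃, ← hF.conj₁]
    exact hF.square [] [(1, true)] 0
  rw [h R M t F hF.toIsSkeinFunction hF.braid, hF.conj₁, hF.conj₂, h5]
  simp only [map_add, map_mul, evalInt_X]
  module


/-! ### Closed braids in the skein module -/

theorem skeinClass_eq_of_moveRel {D D' : LinkDiagram} (h : D.MoveRel D') :
    D.skeinClass = D'.skeinClass :=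
  (Submodule.Quotient.eq _).2 (Submodule.subset_span (.inl ⟨D, D', h, rfl⟩))

theorem skeinClass_skein {D₁ D₀ D₂ : LinkDiagram} (h : IsSkeinTriple D₁ D₀ D₂) :
    D₁.skeinClass = (v * z) • D₀.skeinClass + v ^ 2 • D₂.skeinClass :=
  (Submodule.Quotient.eq _).2 (Submodule.subset_span (.inr ⟨D₁, D₀, D₂, h, rfl⟩))

/-- Scaling by the power of `v` given by the writhe absorbs the factors `v` and `v²`. -/
theorem T_smul_skein {M : Type*} [AddCommGroup M] [Module LaurentVZ M] {x₁ x₀ x₂ : M}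
    (h : x₁ = (v * z) • x₀ + v ^ 2 • x₂) {k₁ k₀ k₂ : ℤ} (h₁ : k₁ = k₀ + 1) (h₂ : k₂ = k₀ - 1) :
    (LaurentPolynomial.T (-k₁) : LaurentVZ) • x₁ =
      z • (LaurentPolynomial.T (-k₀) : LaurentVZ) • x₀ +
        (LaurentPolynomial.T (-k₂) : LaurentVZ) • x₂ := by
  subst h₁ h₂
  rw [h, smul_add, smul_smul, smul_smul, smul_smul]
  congr 2
  · rw [v, ← mul_assoc, ← LaurentPolynomial.T_add, mul_comm]; congr 2; ring
  · rw [v, LaurentPolynomial.T_pow, ← LaurentPolynomial.T_add]; congr 1; push_cast; ring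

theorem BraidWord.writhe_append {n : ℕ} (u w : BraidWord n) :
    (BraidWord.writhe (u ++ w)) = u.writhe + w.writhe := by
  simp [BraidWord.writhe]

/-- The class of the closure, normalised by the writhe. -/
def closureClass {n : ℕ} [NeZero n] (β : BraidWord n) : SkeinModule :=
  (LaurentPolynomial.T (-β.writhe) : LaurentVZ) • β.closure.skeinClass

theorem isSkeinFunction_closureClass (n : ℕ) [NeZero n] :
    IsSkeinFunction z (closureClass (n := n)) where
  cancel u w i ε := by
    have hw : BraidWord.writhe (u ++ [(i, ε), (i, !ε)] ++ w) = BraidWord.writhe (u ++ w) := by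
      simp only [BraidWord.writhe_append]
      cases ε <;> simp [BraidWord.writhe]
    rw [closureClass, closureClass, hw, skeinClass_eq_of_moveRel]
    refine ⟨(List.range n).map (fun i => (i, Piece.cup true)) ++
      u.map (fun g => ((g.1 : ℕ), Piece.cross g.2)), _, _,
      w.map (fun g => ((g.1 : ℕ), Piece.cross g.2)) ++
      (List.range n).reverse.map (fun i => (i, Piece.cap)), .reidemeister₂ i ε, ?_, ?_⟩ <;>
    simp [BraidWord.closure, BraidWord.closureWord]
  skein u w i := by
    have hi : (i : ℕ) + 1 < n := by omega
    refine T_smul_skein (skeinClass_skein ⟨(List.range n).map (fun i => (i, Piece.cup true)) ++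
      u.map (fun g => ((g.1 : ℕ), Piece.cross g.2)),
      w.map (fun g => ((g.1 : ℕ), Piece.cross g.2)) ++
      (List.range n).reverse.map (fun i => (i, Piece.cap)), List.replicate i true,
      List.replicate (n - 2 - i) true ++ List.replicate n false, true, true, ?_, ?_, ?_, ?_⟩) ?_ ?_
    · have := (runs_cups n).append (runs_braid u)
      have e : List.replicate n true =
          List.replicate i true ++ [true, true] ++ List.replicate (n - 2 - i) true := by
        rw [show [true, true] = List.replicate 2 true from rfl, ← List.replicate_add,
          ← List.replicate_add]
        congr 1
        omega
      rw [← List.append_assoc, ← e]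
      exact this
    · simp [BraidWord.closure, BraidWord.closureWord]
    · simp [BraidWord.closure, BraidWord.closureWord]
    · simp [BraidWord.closure, BraidWord.closureWord]
    · simp only [BraidWord.writhe_append]
      simp [BraidWord.writhe]; ring
    · simp only [BraidWord.writhe_append]
      simp [BraidWord.writhe]; ring

/-- The class of the diagram with the given layers. -/
def wordClass (w : List Layer) : SkeinModule :=
  if h : run w [] = some [] ∧ w ≠ [] then
    LinkDiagram.skeinClass ⟨w, runs_iff_run.2 h.1, h.2⟩ else 0

theorem wordClass_word (D : LinkDiagram) : wordClass D.word = D.skeinClass :=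
  dif_pos ⟨runs_iff_run.1 D.runs, D.nonempty⟩

theorem wordClass_move (w₁ w₂ : List Layer) {u u' : List Layer} (hm : Move u u')
    (h : run (w₁ ++ u ++ w₂) [] = some []) (h' : run (w₁ ++ u' ++ w₂) [] = some [])
    (hw : w₁ ≠ []) : wordClass (w₁ ++ u ++ w₂) = wordClass (w₁ ++ u' ++ w₂) := by
  rw [wordClass, wordClass, dif_pos ⟨h, by simp [hw]⟩, dif_pos ⟨h', by simp [hw]⟩]
  exact skeinClass_eq_of_moveRel ⟨w₁, u, u', w₂, hm, rfl, rfl⟩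

theorem run_translate (l : List Bool) (u : List Layer) (s : List Bool) :
    run (u.map fun ℓ => (l.length + ℓ.1, ℓ.2)) (l ++ s) = (run u s).map (l ++ ·) := by
  induction l with
  | nil => simp
  | cons a l ih =>
    have : u.map (fun ℓ : Layer => ((a :: l).length + ℓ.1, ℓ.2)) =
        shift (u.map fun ℓ => (l.length + ℓ.1, ℓ.2)) := by
      simp [shift, Nat.succ_add, Function.comp_def]
    rw [this, List.cons_append, run_shift_cons, ih]
    simp [Function.comp_def]

theorem run_context {w₁ w₂ u : List Layer} {l s t : List Bool} (h₁ : run w₁ [] = some (l ++ s))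
    (h₂ : run w₂ (l ++ t) = some []) (hu : run u s = some t) :
    run (w₁ ++ u.map (fun ℓ => (l.length + ℓ.1, ℓ.2)) ++ w₂) [] = some [] := by
  simp [run_append, h₁, run_translate, hu, h₂]

/-- Markov's stabilisation. -/
theorem wordClass_stabilization {w₁ w₂ : List Layer} {l r : List Bool}
    (h₁ : run w₁ [] = some (l ++ true :: r)) (h₂ : run w₂ (l ++ true :: r) = some [])
    (hw : w₁ ≠ []) (ε : Bool) :
    wordClass (w₁ ++ [(l.length + 1, .cup true), (l.length, .cross ε), (l.length + 1, .cap)] ++ w₂) =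
      wordClass (w₁ ++ w₂) := by
  have r₀ := run_context (u := [(1, .cup true), (0, .cross ε), (1, .cap)]) h₁ h₂ rfl
  have r₁ := run_context (u := [(1, .cup true), (1, .cross !ε), (0, .cap)]) h₁ h₂ rfl
  have r₂ := run_context (u := [(1, .cup false), (0, .cap)]) h₁ h₂ rfl
  have r₃ := run_context (u := []) h₁ h₂ rfl
  simp only [List.map_cons, List.map_nil, add_zero] at r₀ r₁ r₂ r₃
  -- The crossing slides across the maximum, becomes a curl at the minimum and disappears; a zigzag
  -- remains.
  have e₁ := wordClass_move (w₁ ++ [(l.length + 1, .cup true)]) w₂ (.slide_cap l.length ε)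
    (by simpa using r₀) (by simpa using r₁) (by simp)
  have e₂ := wordClass_move w₁ ([(l.length, .cap)] ++ w₂)
    (.reidemeister₁_cup (l.length + 1) true (!ε)) (by simpa using r₁) (by simpa using r₂) hw
  have e₃ := wordClass_move w₁ w₂ (.zigzag l.length false) r₂ r₃ hw
  simp only [List.append_assoc, List.cons_append, List.nil_append] at *
  exact e₁.trans (e₂.trans e₃)

/-- A disjoint circle. -/
theorem wordClass_circle {w₁ w₂ : List Layer} {l r : List Bool}
    (h₁ : run w₁ [] = some (l ++ true :: r)) (h₂ : run w₂ (l ++ true :: r) = some [])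
    (hw : w₁ ≠ []) :
    (v * z) • wordClass (w₁ ++ [(l.length + 1, .cup true), (l.length + 1, .cap)] ++ w₂) =
      (1 - v ^ 2) • wordClass (w₁ ++ w₂) := by
  have r₀ := run_context (u := [(1, .cup true), (1, .cap)]) h₁ h₂ rfl
  have rε := fun ε => run_context (u := [(1, .cup true), (0, .cross ε), (1, .cap)]) h₁ h₂ rfl
  simp only [List.map_cons, List.map_nil, add_zero] at r₀ rε
  have hs := wordClass_stabilization h₁ h₂ hw
  have hr : Runs [] (w₁ ++ [(l.length + 1, .cup true)]) (l ++ [true, true] ++ (false :: r)) := by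
    rw [runs_iff_run, run_append, h₁]
    have := run_translate l [(1, .cup true)] (true :: r)
    simpa [run, next] using this
  -- The circle is the smoothing of a stabilising crossing, and both signs of that crossing give the
  -- same class.
  have h := skeinClass_skein (D₁ := ⟨_, runs_iff_run.2 (rε true), by simp⟩)
    (D₀ := ⟨_, runs_iff_run.2 r₀, by simp⟩) (D₂ := ⟨_, runs_iff_run.2 (rε false), by simp⟩)
    ⟨_, [(l.length + 1, .cap)] ++ w₂, l, _, true, true, hr, by simp, by simp, by simp⟩
  rw [← wordClass_word, ← wordClass_word, ← wordClass_word] at h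
  simp only [hs] at h
  rw [sub_smul, one_smul, eq_sub_iff_add_eq]
  exact h.symm

/-! ### Closures of short braid words -/

def closedTwo (u : List Layer) : SkeinModule :=
  wordClass ([(0, .cup true), (1, .cup true)] ++ u ++ [(1, .cap), (0, .cap)])

def closedThree (u : List Layer) : SkeinModule :=
  wordClass ([(0, .cup true), (1, .cup true), (2, .cup true)] ++ u ++
    [(2, .cap), (1, .cap), (0, .cap)])

theorem closedTwo_nil : (v * z) • closedTwo [] = (1 - v ^ 2) • unknot.skeinClass := by
  rw [← wordClass_word]
  exact wordClass_circle (w₁ := [(0, .cup true)]) (w₂ := [(0, .cap)]) (l := []) (r := [false])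
    rfl rfl (by simp)

theorem closedTwo_crossing (ε : Bool) : closedTwo [(0, .cross ε)] = unknot.skeinClass := by
  rw [← wordClass_word]
  exact wordClass_stabilization (w₁ := [(0, .cup true)]) (w₂ := [(0, .cap)]) (l := [])
    (r := [false]) rfl rfl (by simp) ε

theorem closedThree_nil : (v * z) • closedThree [] = (1 - v ^ 2) • closedTwo [] :=
  wordClass_circle (w₁ := [(0, .cup true), (1, .cup true)]) (w₂ := [(1, .cap), (0, .cap)])
    (l := [true]) (r := [false, false]) rfl rfl (by simp)

/-- Moved below the third minimum, `σ₁` leaves a disjoint circle beside the closure of a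
one-crossing 2-braid. -/
theorem closedThree_first :
    (v * z) • closedThree [(0, .cross true)] = (1 - v ^ 2) • unknot.skeinClass := by
  rw [← closedTwo_crossing true]
  have e := wordClass_move [(0, .cup true), (1, .cup true)] [(2, .cap), (1, .cap), (0, .cap)]
    (.interchange 0 0 (.cross true) (.cup true)) rfl rfl (by simp)
  have h := wordClass_circle (w₁ := [(0, .cup true), (1, .cup true), (0, .cross true)])
    (w₂ := [(1, .cap), (0, .cap)]) (l := [true]) (r := [false, false]) rfl rfl (by simp)
  exact (congrArg ((v * z) • ·) e.symm).trans h

theorem closedThree_second : closedThree [(1, .cross true)] = closedTwo [] :=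
  wordClass_stabilization (w₁ := [(0, .cup true), (1, .cup true)]) (w₂ := [(1, .cap), (0, .cap)])
    (l := [true]) (r := [false, false]) rfl rfl (by simp) true

theorem closedThree_first_second :
    closedThree [(0, .cross true), (1, .cross true)] = unknot.skeinClass := by
  rw [← closedTwo_crossing true]
  have e := wordClass_move [(0, .cup true), (1, .cup true)]
    [(1, .cross true), (2, .cap), (1, .cap), (0, .cap)]
    (.interchange 0 0 (.cross true) (.cup true)) rfl rfl (by simp)
  have h := wordClass_stabilization (w₁ := [(0, .cup true), (1, .cup true), (0, .cross true)])
    (w₂ := [(1, .cap), (0, .cap)]) (l := [true]) (r := [false, false]) rfl rfl (by simp) true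
  exact e.symm.trans h

theorem closedThree_second_first :
    closedThree [(1, .cross true), (0, .cross true)] = unknot.skeinClass := by
  rw [← closedTwo_crossing true]
  have e := wordClass_move [(0, .cup true), (1, .cup true), (2, .cup true), (1, .cross true)]
    [(1, .cap), (0, .cap)] (.interchange 0 0 (.cross true) .cap) rfl rfl (by simp)
  have h := wordClass_stabilization (w₁ := [(0, .cup true), (1, .cup true)])
    (w₂ := [(0, .cross true), (1, .cap), (0, .cap)]) (l := [true]) (r := [false, false])
    rfl rfl (by simp) true
  exact e.trans h

/-- The outer `σ₁`'s are pulled past the third minimum and maximum, after which `σ₂` is removed by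
stabilisation. -/
theorem closedThree_first_second_first :
    closedThree [(0, .cross true), (1, .cross true), (0, .cross true)] =
      closedTwo [(0, .cross true), (0, .cross true)] := by
  have e₁ := wordClass_move [(0, .cup true), (1, .cup true)]
    [(1, .cross true), (0, .cross true), (2, .cap), (1, .cap), (0, .cap)]
    (.interchange 0 0 (.cross true) (.cup true)) rfl rfl (by simp)
  have e₂ := wordClass_move
    [(0, .cup true), (1, .cup true), (0, .cross true), (2, .cup true), (1, .cross true)]
    [(1, .cap), (0, .cap)] (.interchange 0 0 (.cross true) .cap) rfl rfl (by simp)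
  have h := wordClass_stabilization (w₁ := [(0, .cup true), (1, .cup true), (0, .cross true)])
    (w₂ := [(0, .cross true), (1, .cap), (0, .cap)]) (l := [true]) (r := [false, false])
    rfl rfl (by simp) true
  exact e₁.symm.trans (e₂.trans h)

theorem closedThree_first_first_second :
    closedThree [(0, .cross true), (0, .cross true), (1, .cross true)] =
      closedTwo [(0, .cross true), (0, .cross true)] := by
  have e₁ := wordClass_move [(0, .cup true), (1, .cup true)]
    [(0, .cross true), (1, .cross true), (2, .cap), (1, .cap), (0, .cap)]
    (.interchange 0 0 (.cross true) (.cup true)) rfl rfl (by simp)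
  have e₂ := wordClass_move [(0, .cup true), (1, .cup true), (0, .cross true)]
    [(1, .cross true), (2, .cap), (1, .cap), (0, .cap)]
    (.interchange 0 0 (.cross true) (.cup true)) rfl rfl (by simp)
  have h := wordClass_stabilization
    (w₁ := [(0, .cup true), (1, .cup true), (0, .cross true), (0, .cross true)])
    (w₂ := [(1, .cap), (0, .cap)]) (l := [true]) (r := [false, false]) rfl rfl (by simp) true
  exact e₁.symm.trans (e₂.symm.trans h)

theorem closureClass_two (β : BraidWord 2) : closureClass β =
    (LaurentPolynomial.T (-β.writhe) : LaurentVZ) •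
      closedTwo (β.map fun g => ((g.1 : ℕ), Piece.cross g.2)) := by
  rw [closureClass, ← wordClass_word]
  rfl

theorem closureClass_three (β : BraidWord 3) : closureClass β =
    (LaurentPolynomial.T (-β.writhe) : LaurentVZ) •
      closedThree (β.map fun g => ((g.1 : ℕ), Piece.cross g.2)) := by
  rw [closureClass, ← wordClass_word]
  rfl

/-- The value `(v⁻¹ - v) / z` of a disjoint circle. -/
def circleValue : LaurentVZ :=
  LaurentPolynomial.C (LaurentPolynomial.T (-1)) * (LaurentPolynomial.T (-1) - v)

theorem v_mul_z_mul_circleValue : v * z * circleValue = 1 - v ^ 2 := by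
  have h1 : z * LaurentPolynomial.C (LaurentPolynomial.T (-1)) = 1 := by
    rw [z, ← map_mul, ← LaurentPolynomial.T_add]; simp
  have h2 : v * LaurentPolynomial.T (-1) = 1 := by
    rw [v, ← LaurentPolynomial.T_add]; simp
  rw [circleValue]
  linear_combination (1 - v ^ 2) * h1 + z * LaurentPolynomial.C (LaurentPolynomial.T (-1)) * h2

theorem isUnit_v_mul_z : IsUnit (v * z) :=
  (LaurentPolynomial.isUnit_T 1).mul ((LaurentPolynomial.isUnit_T 1).map LaurentPolynomial.C)

theorem eq_circleValue_smul {x y : SkeinModule} (h : (v * z) • x = (1 - v ^ 2) • y) :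
    x = circleValue • y := by
  rw [← v_mul_z_mul_circleValue, mul_smul (v * z)] at h
  exact isUnit_v_mul_z.smul_left_cancel.1 h

theorem writhe_cons {n : ℕ} (i : Fin (n - 1)) (ε : Bool) (β : BraidWord n) :
    BraidWord.writhe ((i, ε) :: β) = (if ε then 1 else -1) + β.writhe := by
  simp [BraidWord.writhe]

theorem writhe_nil {n : ℕ} : BraidWord.writhe ([] : BraidWord n) = 0 := rfl

theorem closureClass_one : closureClass ([] : BraidWord 3) =
    (circleValue ^ 2) • unknot.skeinClass := by
  rw [closureClass_three, writhe_nil, neg_zero, LaurentPolynomial.T_zero, one_smul, pow_two, mul_smul,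
    ← eq_circleValue_smul closedTwo_nil]
  exact eq_circleValue_smul closedThree_nil

theorem closureClass_first : closureClass ([(0, true)] : BraidWord 3) =
    (LaurentPolynomial.T (-1) * circleValue : LaurentVZ) • unknot.skeinClass := by
  rw [closureClass_three, mul_smul, ← eq_circleValue_smul closedThree_first]
  rfl

theorem closureClass_first_second : closureClass ([(0, true), (1, true)] : BraidWord 3) =
    (LaurentPolynomial.T (-2) : LaurentVZ) • unknot.skeinClass := by
  rw [closureClass_three, ← closedThree_first_second]
  rfl

/-- General conjugation invariance is not needed: the three required equalities come from evaluating
the closures by stabilisation and the circle relation. -/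
theorem isSkeinTrace_closureClass : IsSkeinTrace z (closureClass (n := 3)) where
  __ := isSkeinFunction_closureClass 3
  braid u w := by
    have hw : BraidWord.writhe (u ++ [(0, true), (1, true), (0, true)] ++ w : BraidWord 3) =
        BraidWord.writhe (u ++ [(1, true), (0, true), (1, true)] ++ w : BraidWord 3) := by
      simp only [BraidWord.writhe_append]
      simp [BraidWord.writhe]
    rw [closureClass, closureClass, hw, skeinClass_eq_of_moveRel]
    refine ⟨(List.range 3).map (fun i => (i, Piece.cup true)) ++
      u.map (fun g => ((g.1 : ℕ), Piece.cross g.2)), _, _,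
      w.map (fun g => ((g.1 : ℕ), Piece.cross g.2)) ++
      (List.range 3).reverse.map (fun i => (i, Piece.cap)),
      .reidemeister₃ 0 true true true (fun _ => rfl), ?_, ?_⟩ <;>
    simp [BraidWord.closure, BraidWord.closureWord]
  conj₁ := by
    rw [closureClass_first, closureClass_three, mul_smul, ← eq_circleValue_smul closedTwo_nil,
      ← closedThree_second]
    rfl
  conj₂ := by
    rw [closureClass_first_second, closureClass_three, ← closedThree_second_first]
    rfl
  conj₃ := by
    rw [closureClass_three, closureClass_three]
    exact congrArg _ (closedThree_first_second_first.trans closedThree_first_first_second.symm)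

/-! ### Conway polynomials -/

/-- The substitution `v = 1`. -/
def atOne : LaurentVZ →+* ℤ[T;T⁻¹] := LaurentPolynomial.eval₂ (RingHom.id ℤ[T;T⁻¹]) 1

theorem atOne_T (k : ℤ) : atOne (LaurentPolynomial.T k) = 1 := by simp [atOne]

theorem atOne_C (r : ℤ[T;T⁻¹]) : atOne (LaurentPolynomial.C r) = r := by simp [atOne]

theorem atOne_circleValue : atOne circleValue = 0 := by
  simp [circleValue, v, atOne_T]

theorem homflypt_closure {n : ℕ} [NeZero n] {β : BraidWord n} {f : LaurentVZ}
    (h : closureClass β = f • unknot.skeinClass) :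
    homflypt β.closure = LaurentPolynomial.T β.writhe * f := by
  apply homflypt_eq
  rw [mul_smul, ← h, closureClass, smul_smul, ← LaurentPolynomial.T_add]
  simp

theorem conway_closure {n : ℕ} [NeZero n] {β : BraidWord n} {f : LaurentVZ}
    (h : closureClass β = f • unknot.skeinClass) : conway β.closure = atOne f := by
  change atOne (homflypt β.closure) = _
  rw [homflypt_closure h, map_mul, atOne_T, one_mul]

/-- Two consecutive exponents are carried along so that the three-term recursion runs in both
directions. -/
theorem exists_closureClass_twist (p : ℤ) :
    (∃ f : LaurentVZ, closureClass (twist p) = f • unknot.skeinClass) ∧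
      ∃ f : LaurentVZ, closureClass (twist (p + 1)) = f • unknot.skeinClass := by
  have H := isSkeinFunction_closureClass 2
  induction p using Int.induction_on with
  | zero =>
    refine ⟨⟨circleValue, ?_⟩, LaurentPolynomial.T (-1), ?_⟩
    · rw [closureClass_two, ← eq_circleValue_smul closedTwo_nil]
      change (LaurentPolynomial.T 0 : LaurentVZ) • closedTwo [] = _
      rw [LaurentPolynomial.T_zero, one_smul]
    · rw [closureClass_two, ← closedTwo_crossing true]
      rfl
  | succ p ih =>
    obtain ⟨⟨f, hf⟩, g, hg⟩ := ih
    refine ⟨⟨g, hg⟩, z * g + f, ?_⟩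
    rw [H.twist_add_one, hg, add_sub_cancel_right, hf, add_smul, mul_smul]
  | pred p ih =>
    obtain ⟨⟨f, hf⟩, g, hg⟩ := ih
    refine ⟨⟨g - z * f, ?_⟩, f, by simpa using hf⟩
    have := H.twist_add_one (-p)
    rw [hf, hg] at this
    rw [sub_smul, mul_smul, this, add_sub_cancel_left]

theorem torusConway_zero : torusConway 0 = 0 := by
  rw [torusConway, conway_closure (f := circleValue), atOne_circleValue]
  rw [closureClass_two, ← eq_circleValue_smul closedTwo_nil]
  change (LaurentPolynomial.T 0 : LaurentVZ) • closedTwo [] = _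
  rw [LaurentPolynomial.T_zero, one_smul]

theorem torusConway_one : torusConway 1 = 1 := by
  rw [torusConway, conway_closure (f := LaurentPolynomial.T (-1)), atOne_T]
  rw [closureClass_two, ← closedTwo_crossing true]
  rfl

theorem torusConway_add_one (p : ℤ) :
    torusConway (p + 1) = LaurentPolynomial.T 1 * torusConway p + torusConway (p - 1) := by
  obtain ⟨f, hf⟩ := (exists_closureClass_twist p).1
  obtain ⟨g, hg⟩ := (exists_closureClass_twist (p - 1)).1
  have h := (isSkeinFunction_closureClass 2).twist_add_one p
  rw [hf, hg, ← mul_smul, ← add_smul] at h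
  rw [torusConway, torusConway, torusConway, conway_closure hf, conway_closure hg, conway_closure h,
    map_add, map_mul, z, atOne_C]

/-- A function of the writhe alone satisfies the braid and conjugation conditions, whose two sides
have equal writhe; the skein relation is the recursion of `torusConway`. -/
theorem isSkeinTrace_torusConway (k : ℤ) : IsSkeinTrace (LaurentPolynomial.T 1 : ℤ[T;T⁻¹])
    (fun β : BraidWord 3 => torusConway (β.writhe + k)) where
  cancel u w i ε := by
    simp only [BraidWord.writhe_append]
    cases ε <;> simp [BraidWord.writhe]
  skein u w i := by
    have h := torusConway_add_one (BraidWord.writhe u + BraidWord.writhe w + k)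
    simp only [BraidWord.writhe_append, writhe_cons, writhe_nil, smul_eq_mul]
    simp only [if_true, Bool.false_eq_true, if_false]
    rw [show u.writhe + (1 + 0) + w.writhe + k = u.writhe + w.writhe + k + 1 by ring,
      show u.writhe + (-1 + 0) + w.writhe + k = u.writhe + w.writhe + k - 1 by ring]
    exact h
  braid u w := by
    simp only [BraidWord.writhe_append]
    simp [BraidWord.writhe]
  conj₁ := by simp [BraidWord.writhe]
  conj₂ := by simp [BraidWord.writhe]
  conj₃ := by simp [BraidWord.writhe]

/-! ### The standard form -/

theorem evalInt_eq {R : Type} [CommRing R] {t : R} {f : ℤ[X] →+* R} (h : f .X = t) (c : ℤ[X]) :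
    evalInt t c = f c := by
  refine congrArg (fun f : ℤ[X] →+* R => f c) (Polynomial.ringHom_ext' (RingHom.ext_int _ _) ?_)
  rw [evalInt_X, h]

theorem evalInt_z (c : ℤ[X]) : evalInt z c = LaurentPolynomial.C (Polynomial.toLaurent c) :=
  evalInt_eq (f := LaurentPolynomial.C.comp Polynomial.toLaurent) (by simp [z]) c

theorem evalInt_T (c : ℤ[X]) :
    evalInt (LaurentPolynomial.T 1 : ℤ[T;T⁻¹]) c = Polynomial.toLaurent c :=
  evalInt_eq (by simp) c

theorem isStandardForm_unique {β : BraidWord 3} {p p' : Fin 3 → ℤ[X]} (h : IsStandardForm β p)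
    (h' : IsStandardForm β p') : p = p' := by
  rw [IsStandardForm] at h h'
  rw [h] at h'
  have e := (LaurentPolynomial.isUnit_T (R := ℤ[T;T⁻¹]) β.writhe).mul_left_cancel h'
  -- Rewritten as a polynomial in `v`, the sum shows its summands as the coefficients of degrees 0,
  -- 2 and 4.
  have key : ∀ p : Fin 3 → ℤ[X], ∑ j : Fin 3,
      LaurentPolynomial.C (Polynomial.toLaurent (p j)) * v ^ (2 * (j : ℕ)) =
      Polynomial.toLaurent (∑ j : Fin 3, Polynomial.monomial (2 * (j : ℕ))
        (Polynomial.toLaurent (p j))) := by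
    intro p
    simp only [map_sum, v, LaurentPolynomial.T_pow,
      ← Polynomial.C_mul_X_pow_eq_monomial]
    simp
  rw [key, key] at e
  have e := Polynomial.toLaurent_injective e
  simp only [Fin.sum_univ_three] at e
  have e' := fun n => congrArg (fun P => Polynomial.coeff P n) e
  simp only [Polynomial.coeff_add, Polynomial.coeff_monomial] at e'
  have h0 := e' 0
  have h1 := e' 2
  have h2 := e' 4
  simp at h0 h1 h2
  ext1 j
  fin_cases j
  · exact h0
  · exact h1
  · exact h2

theorem exists_standardForm (β : BraidWord 3) : ∃ p : Fin 3 → ℤ[X], IsStandardForm β p ∧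
    Polynomial.toLaurent (p 0) = torusConway (β.writhe + 1) - conway β.closure ∧
    Polynomial.toLaurent (p 1) = LaurentPolynomial.T 2 * conway β.closure -
      Polynomial.toLaurent (p 0) - Polynomial.toLaurent (p 2) ∧
    Polynomial.toLaurent (p 2) = torusConway (β.writhe - 1) - conway β.closure := by
  obtain ⟨a, b, c, h⟩ := exists_trace_coeff β
  have hβ := h _ _ z _ isSkeinTrace_closureClass
  -- The words `1`, `σ₁`, `σ₁σ₂` have writhe 0, 1, 2, so the shifts by `1` and `-1` involve `C_1,
  -- C_2, C_3` and `C_{-1}, C_0, C_1`.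
  have h₁ := h _ _ _ _ (isSkeinTrace_torusConway 1)
  have h₂ := h _ _ _ _ (isSkeinTrace_torusConway (-1))
  rw [closureClass_one, closureClass_first, closureClass_first_second, ← mul_smul, ← mul_smul,
    ← mul_smul, ← add_smul, ← add_smul] at hβ
  have hP := homflypt_closure hβ
  have hC := conway_closure hβ
  have t₀ : torusConway (-1) = 1 := by
    have h := torusConway_add_one 0
    rw [zero_add, zero_sub, torusConway_one, torusConway_zero] at h
    simpa using h.symm
  have t₂ : torusConway 2 = LaurentPolynomial.T 1 := by
    have h := torusConway_add_one 1
    rw [sub_self, torusConway_one, torusConway_zero] at h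
    simpa using h
  have t₃ : torusConway 3 = LaurentPolynomial.T 1 * LaurentPolynomial.T 1 + 1 := by
    have h := torusConway_add_one 2
    rw [t₂, show (2 : ℤ) - 1 = 1 by norm_num, torusConway_one] at h
    exact h
  simp only [writhe_nil, writhe_cons, evalInt_T, smul_eq_mul, if_true, zero_add, add_zero] at h₁ h₂
  norm_num [t₀, t₂, t₃, torusConway_zero, torusConway_one] at h₁ h₂
  simp only [map_add, map_mul, map_pow, atOne_circleValue, atOne_T, evalInt_z, atOne_C] at hC
  have hC : conway β.closure = Polynomial.toLaurent c := by rw [hC]; ring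
  have hX : LaurentPolynomial.C (LaurentPolynomial.T 1) = z := rfl
  have hT : (LaurentPolynomial.T 2 : ℤ[T;T⁻¹]) = LaurentPolynomial.T 1 * LaurentPolynomial.T 1 := by
    rw [← LaurentPolynomial.T_add]; rfl
  -- Coefficients of `1`, `v²`, `v⁴` in `a(1 - v²)² + bz(1 - v²) + cz²`.
  refine ⟨![a + .X * b + .X ^ 2 * c, -2 * a - .X * b, a], ?_, ?_, ?_, ?_⟩
  · have k₀ := v_mul_z_mul_circleValue
    have k₁ : LaurentPolynomial.T (-1) * v = 1 := by
      rw [v, ← LaurentPolynomial.T_add]; simp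
    have k₂ : LaurentPolynomial.T (-2) * v ^ 2 = 1 := by
      rw [v, LaurentPolynomial.T_pow, ← LaurentPolynomial.T_add]; simp
    rw [IsStandardForm, hP]
    simp only [evalInt_z, Fin.sum_univ_three, Matrix.cons_val_zero, Matrix.cons_val_one,
      Matrix.cons_val_two, Matrix.head_cons, Matrix.tail_cons, map_add, map_mul,
      map_sub, map_neg, map_pow, map_ofNat, Polynomial.toLaurent_X, hX, Fin.val_zero, Fin.val_one,
      Fin.val_two]
    generalize LaurentPolynomial.C (Polynomial.toLaurent a) = A
    generalize LaurentPolynomial.C (Polynomial.toLaurent b) = B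
    generalize LaurentPolynomial.C (Polynomial.toLaurent c) = Γ
    linear_combination LaurentPolynomial.T β.writhe *
      (A * (v * z * circleValue + 1 - v ^ 2) * k₀ + B * z * (v * z * circleValue) * k₁ +
        B * z * k₀ + Γ * z ^ 2 * k₂)
  · rw [h₁, hC]
    simp only [Matrix.cons_val_zero, map_add, map_mul, map_pow, Polynomial.toLaurent_X]
    ring
  · rw [hC, hT]
    simp only [Matrix.cons_val_zero, Matrix.cons_val_one, Matrix.cons_val, map_add, map_mul,
      map_pow, map_sub, map_neg, map_ofNat, Polynomial.toLaurent_X]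
    ring
  · rw [sub_eq_add_neg β.writhe, h₂, hC]
    simp [Matrix.cons_val]

end Homflypt

end

/-! ### The proposition -/

theorem mainTheorem5 :
    (∀ β : Homflypt.BraidWord 3,
      (∃! p : Fin 3 → Polynomial ℤ, Homflypt.IsStandardForm β p) ∧
      ∀ p : Fin 3 → Polynomial ℤ, Homflypt.IsStandardForm β p →
        Polynomial.toLaurent (p 0) =
          Homflypt.torusConway (β.writhe + 1) - Homflypt.conway β.closure ∧
        Polynomial.toLaurent (p 1) =
          LaurentPolynomial.T 2 * Homflypt.conway β.closure
            - Polynomial.toLaurent (p 0) - Polynomial.toLaurent (p 2) ∧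
        Polynomial.toLaurent (p 2) =
          Homflypt.torusConway (β.writhe - 1) - Homflypt.conway β.closure) ∧
    (∀ β γ : Homflypt.BraidWord 3, β.writhe = γ.writhe →
      Homflypt.conway β.closure = Homflypt.conway γ.closure →
      Homflypt.homflypt β.closure = Homflypt.homflypt γ.closure) := by
  refine ⟨fun β => ?_, fun β γ hw hc => ?_⟩
  · obtain ⟨p, hp, h⟩ := Homflypt.exists_standardForm β
    refine ⟨⟨p, hp, fun p' hp' => Homflypt.isStandardForm_unique hp' hp⟩, fun p' hp' => ?_⟩
    rw [Homflypt.isStandardForm_unique hp' hp]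
    exact h
  · obtain ⟨p, hp, h0, h1, h2⟩ := Homflypt.exists_standardForm β
    obtain ⟨p', hp', h0', h1', h2'⟩ := Homflypt.exists_standardForm γ
    have e0 : p 0 = p' 0 := Polynomial.toLaurent_injective (by rw [h0, h0', hw, hc])
    have e2 : p 2 = p' 2 := Polynomial.toLaurent_injective (by rw [h2, h2', hw, hc])
    have e1 : p 1 = p' 1 := Polynomial.toLaurent_injective (by rw [h1, h1', e0, e2, hc])
    have e : p = p' := by
      ext1 j
      fin_cases j
      · exact e0
      · exact e1
      · exact e2
    subst e
    -- Equal standard forms give equal products of the polynomials with the unit `(vz)²`.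
    rw [Homflypt.IsStandardForm, hw, ← hp'] at hp
    exact (Homflypt.isUnit_v_mul_z.pow _).mul_right_cancel hp
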